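/- Let $F_q$ be a finite field of odd characteristic, $A=F_q[y]$ with $y^2=0$, and let $*$ be the involution $(r+sy)^*=r-sy$ of $A$. Let $V$ be a free $A$-module of finite rank $m$, let $h:V\times V\to A$ be a non-degenerate $*$-hermitian form ($A$-linear in the second variable, $h(v,u)=h(u,v)^*$, and $v\mapsto h(v,-)$ an isomorphism of $V$ onto its dual), and let $U=U_m(A)$ be its unitary group. Put $V_0=yV$; a vector of $V$ is primitive if it is not in $V_0$. Let $\lambda:F_q^+\to\mathbb C^\times$ be a non-trivial linear character and $\mu(r+sy)=\lambda(2s)$. Let $H$ be the Heisenberg group of all pairs $(a,v)$, $a\in A$, $v\in V$, with $(a,v)(b,w)=(a+b+h(v,w),v+w)$, on which $U$ acts by $(a,v)\mapsto(a,gv)$. Let $Z=\mathbb C\zeta$ be the one-dimensional module of $(A,V_0)\rtimes U$ on which $(a,u)g$ acts as $\mu(a)$, and let $X=\mathrm{ind}_{(A,V_0)\rtimes U}^{H\rtimes U}Z$, considered as a $U$-module (the Weil module of type $\mu$). Write $e_v=(0,v)\otimes\zeta$ for $v\in V$, and for a primitive vector $s$ let $Top^{\pm}(s)$ be the $U$-submodule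 of $X$ generated by $e_s\pm e_{-s}$. Let $b$ be the non-degenerate symmetric bilinear form induced by $h$ on the $F_q$-space $W=V/yV$, with values in $A/Ay=F_q$, and let $O$ be its orthogonal group. Fix a non-square $\delta\in F_q^\times$. We say that $b$ has type $c$, where $c\in\{1,\delta\}$, if $b$ has in some basis of $W$ a diagonal matrix with diagonal $1,-1,\dots,1,-c$ ($m$ even) or $1,-1,\dots,1,-1,-c$ ($m$ odd). Let $s\in V$ be primitive and $t=h(s,s)\in F_q$. Then each of $Top^+(s)$ and $Top^-(s)$ is an irreducible $U$-module, of degree $[O:S_t]/2$, where $S_t$ is the stabilizer in $O$ of any non-zero vector $u\in W$ with $b(u,u)=t$. Moreover, $b$ has type $1$ or type $\delta$, if $m=2$ and $b$ has type $\delta$ then $t\ne0$, and for $m=2r$ or $m=2r+1$ with $r\ge1$ the degree is given as follows. * $\deg Top^\pm(s)=\dfrac{q^r(q^r+1)}{2}$ if $m=2r+1$ and: $b$ has type $1$, $-1\in F_q^{\times2}$, $t\in F_q^{\times2}$; or $b$ has type $1$, $-1\notin F_q^{\times2}$, $t\in F_q^\times\setminus F_q^{\times2}$; or $b$ has type $\delta$,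 $-1\in F_q^{\times2}$, $t\in F_q^\times\setminus F_q^{\times2}$; or $b$ has type $\delta$, $-1\notin F_q^{\times2}$, $t\in F_q^{\times2}$. * $\deg Top^\pm(s)=\dfrac{q^r(q^r-1)}{2}$ if $m=2r+1$ and: $b$ has type $1$, $-1\in F_q^{\times2}$, $t\in F_q^\times\setminus F_q^{\times2}$; or $b$ has type $1$, $-1\notin F_q^{\times2}$, $t\in F_q^{\times2}$; or $b$ has type $\delta$, $-1\in F_q^{\times2}$, $t\in F_q^{\times2}$; or $b$ has type $\delta$, $-1\notin F_q^{\times2}$, $t\in F_q^\times\setminus F_q^{\times2}$. * $\deg Top^\pm(s)=\dfrac{q^{r-1}(q^r+1)}{2}$ if $m=2r$, $b$ has type $\delta$ and $t\ne0$. * $\deg Top^\pm(s)=\dfrac{q^{r-1}(q^r-1)}{2}$ if $m=2r$, $b$ has type $1$ and $t\ne0$. * $\deg Top^\pm(s)=\dfrac{(q^r-1)(q^{r-1}+1)}{2}$ if $m=2r$, $b$ has type $1$ and $t=0$. * $\deg Top^\pm(s)=\dfrac{(q^r+1)(q^{r-1}-1)}{2}$ if $m=2r>2$, $b$ has type $\delta$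 and $t=0$. * $\deg Top^\pm(s)=\dfrac{q^{2r}-1}{2}$ if $m=2r+1$, $b$ has either type and $t=0$. -/

import Mathlib

open scoped DualNumber

namespace RamifiedWeil

noncomputable section

variable {F : Type*} [Field F] {V : Type*} [AddCommGroup V] [Module F[ε] V]

/-! ### The ring `A = F[ε]` -/

/-- The involution `(r + s ε)^* = r - s ε` of `F[ε]`. -/
def conj (F : Type*) [Field F] : F[ε] →+* F[ε] where
  toFun a := TrivSqZeroExt.inl a.fst + TrivSqZeroExt.inr (-a.snd)
  map_one' := by ext <;> simp
  map_mul' a b := by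
    ext
    · simp
    · simp; ring
  map_zero' := by ext <;> simp
  map_add' a b := by
    ext
    · simp
    · simp; ring

/-- The map `d : A → F`, `d (r + s ε) = 2 s`. -/
def dMap (F : Type*) [Field F] : F[ε] →+ F where
  toFun a := 2 * a.snd
  map_zero' := by simp
  map_add' a b := by simp [mul_add]

/-- The linear character `μ = χ ∘ d` of the additive group of `A`. -/
def muChar (χ : AddChar F ℂ) : AddChar F[ε] ℂ := χ.compAddMonoidHom (dMap F)

/-! ### Hermitian forms and the unitary group -/

/-- Forms `V × V → A` that are `A`-linear in the second variable and conjugate linear in the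
first one. -/
abbrev SesqForm (F V : Type*) [Field F] [AddCommGroup V] [Module F[ε] V] :=
  V →ₛₗ[conj F] V →ₗ[F[ε]] F[ε]

/-- `h` is `*`-hermitian. -/
def IsHermitian (h : SesqForm F V) : Prop := ∀ u v, h v u = conj F (h u v)

/-- `h` is non-degenerate: `v ↦ h(v, -)` is an isomorphism of `V` onto its dual. -/
def Nondegenerate (h : SesqForm F V) : Prop := Function.Bijective h

/-- The unitary group `U` of `h`: all `A`-linear automorphisms of `V` preserving `h`. -/
def unitaryGroup (h : SesqForm F V) : Subgroup (V ≃ₗ[F[ε]] V) where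
  carrier := {g | ∀ u v, h (g u) (g v) = h u v}
  mul_mem' {a b} ha hb u v := by
    simp only [Set.mem_ofPred_eq] at ha hb
    rw [LinearEquiv.mul_apply, LinearEquiv.mul_apply, ha, hb]
  one_mem' u v := rfl
  inv_mem' {a} ha u v := by
    have := ha (a⁻¹ u) (a⁻¹ v)
    rw [← LinearEquiv.mul_apply, ← LinearEquiv.mul_apply, mul_inv_cancel] at this
    exact this.symm

variable (F V) in
/-- The submodule `V₀ = 𝔦 V`, where `𝔦 = A ε` is the maximal ideal of `A`. A vector is primitive
if it does not lie in `V₀`. -/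
def V0 : Submodule F[ε] V := Ideal.span {(ε : F[ε])} • ⊤

lemma mem_V0 {u : V} : u ∈ V0 F V ↔ ∃ w : V, u = (ε : F[ε]) • w := by
  rw [V0, Submodule.ideal_span_singleton_smul]
  constructor
  · rintro ⟨w, -, rfl⟩
    exact ⟨w, rfl⟩
  · rintro ⟨w, rfl⟩
    exact ⟨w, trivial, rfl⟩

lemma map_mem_V0 (g : V →ₗ[F[ε]] V) {u : V} (hu : u ∈ V0 F V) : g u ∈ V0 F V := by
  obtain ⟨w, rfl⟩ := mem_V0.1 hu
  exact mem_V0.2 ⟨g w, map_smul g _ _⟩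

/-! ### The Heisenberg group and the Weil module -/

/-- The Heisenberg group `H(h)`: pairs `(a, v)` with `a ∈ A`, `v ∈ V`, multiplied by
`(a, v) (b, w) = (a + b + h(v, w), v + w)`. -/
@[ext]
structure Heisenberg (h : SesqForm F V) where
  scal : F[ε]
  vec : V

namespace Heisenberg

variable {h : SesqForm F V}

instance : Mul (Heisenberg h) := ⟨fun x y => ⟨x.scal + y.scal + h x.vec y.vec, x.vec + y.vec⟩⟩
instance : One (Heisenberg h) := ⟨⟨0, 0⟩⟩
instance : Inv (Heisenberg h) := ⟨fun x => ⟨-x.scal + h x.vec x.vec, -x.vec⟩⟩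

@[simp] lemma mul_scal (x y : Heisenberg h) :
    (x * y).scal = x.scal + y.scal + h x.vec y.vec := rfl
@[simp] lemma mul_vec (x y : Heisenberg h) : (x * y).vec = x.vec + y.vec := rfl
@[simp] lemma one_scal : (1 : Heisenberg h).scal = 0 := rfl
@[simp] lemma one_vec : (1 : Heisenberg h).vec = 0 := rfl
@[simp] lemma inv_scal (x : Heisenberg h) : (x⁻¹).scal = -x.scal + h x.vec x.vec := rfl
@[simp] lemma inv_vec (x : Heisenberg h) : (x⁻¹).vec = -x.vec := rfl

instance : Group (Heisenberg h) :=
  Group.ofLeftAxioms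
    (fun x y z => Heisenberg.ext
      (by simp only [mul_scal, mul_vec, map_add, LinearMap.add_apply]; abel)
      (by simp only [mul_vec]; abel))
    (fun x => Heisenberg.ext (by simp) (by simp))
    (fun x => Heisenberg.ext (by simp) (by simp))

/-- The action of the unitary group on the Heisenberg group, `(a, v) ↦ (a, g v)`. -/
def action (h : SesqForm F V) : unitaryGroup h →* MulAut (Heisenberg h) where
  toFun g :=
    { toFun := fun x => ⟨x.scal, g.1 x.vec⟩
      invFun := fun x => ⟨x.scal, g.1.symm x.vec⟩
      left_inv := fun x => by simp
      right_inv := fun x => by simp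
      map_mul' := fun x y => Heisenberg.ext
        (by simp only [mul_scal, g.2 x.vec y.vec]) (by simp only [mul_vec, map_add]) }
  map_one' := rfl
  map_mul' _ _ := rfl

end Heisenberg

/-- The group `H ⋊ U`. -/
abbrev HeisenbergUnitary (h : SesqForm F V) :=
  Heisenberg h ⋊[Heisenberg.action h] unitaryGroup h

/-- The subgroup `(A, V₀) ⋊ U` of `H ⋊ U`. -/
def polarization (h : SesqForm F V) : Subgroup (HeisenbergUnitary h) where
  carrier := {x | x.left.vec ∈ V0 F V}
  mul_mem' {x _} hx hy :=
    (V0 F V).add_mem hx (map_mem_V0 x.right.1.toLinearMap hy)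
  one_mem' := (V0 F V).zero_mem
  inv_mem' {x} hx :=
    map_mem_V0 (x.right⁻¹).1.toLinearMap ((V0 F V).neg_mem hx)

lemma form_V0_V0 (h : SesqForm F V) {u w : V} (hu : u ∈ V0 F V) (hw : w ∈ V0 F V) :
    h u w = 0 := by
  obtain ⟨u, rfl⟩ := mem_V0.1 hu
  obtain ⟨w, rfl⟩ := mem_V0.1 hw
  have : conj F ε * ε = 0 := by ext <;> simp [conj]
  rw [map_smul, LinearMap.map_smulₛₗ, LinearMap.smul_apply, smul_smul, mul_comm, this, zero_smul]

/-- The one-dimensional module `Z = ℂ ζ`, `ζ = 1`, on which `(a, u) g` acts as `μ(a)`. -/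
def polChar (h : SesqForm F V) (χ : AddChar F ℂ) : Representation ℂ (polarization h) ℂ where
  toFun x := muChar χ x.1.left.scal • LinearMap.id
  map_one' := by
    ext
    simp
  map_mul' x y := by
    have h0 : h x.1.left.vec (x.1.right.1 y.1.left.vec) = 0 :=
      form_V0_V0 h x.2 (map_mem_V0 x.1.right.1.toLinearMap y.2)
    have h1 : (x * y).1.left.scal = x.1.left.scal + y.1.left.scal := by
      change x.1.left.scal + y.1.left.scal + h x.1.left.vec (x.1.right.1 y.1.left.vec) = _
      rw [h0, add_zero]
    ext
    simp only [h1, AddChar.map_add_eq_mul]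
    simp [mul_comm]

/-- The Weil module `X = ind_{(A, V₀) ⋊ U}^{H ⋊ U} Z = ℂ[H ⋊ U] ⊗ Z`. -/
abbrev WeilModule (h : SesqForm F V) (χ : AddChar F ℂ) :=
  Representation.IndV (polarization h).subtype (polChar h χ)

/-- The Weil representation of the unitary group on `X`, the restriction to `U` of the induced
representation of `H ⋊ U`. -/
def weilRep (h : SesqForm F V) (χ : AddChar F ℂ) :
    Representation ℂ (unitaryGroup h) (WeilModule h χ) :=
  (Representation.ind (polarization h).subtype (polChar h χ)).comp SemidirectProduct.inr

/-- The element `e_v = (0, v) ⊗ ζ` of `X`. In the convention for induced modules used here, the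
pure tensor `x ⊗ ζ` is the class `mk x⁻¹ ζ`. -/
def eVec (h : SesqForm F V) (χ : AddChar F ℂ) (v : V) : WeilModule h χ :=
  Representation.IndV.mk (polarization h).subtype (polChar h χ)
    (SemidirectProduct.inl (⟨0, v⟩ : Heisenberg h))⁻¹ 1

/-- The `U`-submodule `Top^±(s)` of `X` generated by `e_s ± e_{-s}`, the sign being `σ`. -/
def topConst (h : SesqForm F V) (χ : AddChar F ℂ) (σ : ℤˣ) (s : V) :
    Subrepresentation (weilRep h χ) where
  toSubmodule := Submodule.span ℂ
    (Set.range fun g : unitaryGroup h =>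
      weilRep h χ g (eVec h χ s + ((σ : ℤ) : ℂ) • eVec h χ (-s)))
  apply_mem_toSubmodule g v hv := by
    induction hv using Submodule.span_induction with
    | mem x hx =>
      obtain ⟨g', rfl⟩ := hx
      refine Submodule.subset_span ⟨g * g', ?_⟩
      simp only [map_mul]
      rfl
    | zero => rw [map_zero]; exact Submodule.zero_mem _
    | add x y _ _ hx hy => rw [map_add]; exact Submodule.add_mem _ hx hy
    | smul c x _ hx => rw [map_smul]; exact Submodule.smul_mem _ _ hx

/-! ### The reduced form and its orthogonal group -/

variable [Module F V] [IsScalarTower F F[ε] V]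

variable (F V) in
/-- The reduced space `W = V / 𝔦 V`, a vector space over `F = A / 𝔦`. -/
abbrev ReducedSpace := V ⧸ V0 F V

/-- The form `b = h mod 𝔦` on `W = V / 𝔦 V`, with values in `A / 𝔦 = F`. -/
def reducedForm (h : SesqForm F V) : LinearMap.BilinForm F (ReducedSpace F V) :=
  LinearMap.mk₂ F
    (fun x y => Quotient.liftOn₂' x y (fun v w => (h v w).fst) (by
      intro v w v' w' hv hw
      obtain ⟨a, ha⟩ := mem_V0.1 ((Submodule.quotientRel_def _).1 hv)
      obtain ⟨c, hc⟩ := mem_V0.1 ((Submodule.quotientRel_def _).1 hw)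
      obtain rfl := sub_eq_iff_eq_add.1 ha
      obtain rfl := sub_eq_iff_eq_add.1 hc
      simp [conj]))
    (by
      rintro ⟨x⟩ ⟨x'⟩ ⟨y⟩
      change (h (x + x') y).fst = (h x y).fst + (h x' y).fst
      simp)
    (by
      rintro c ⟨x⟩ ⟨y⟩
      change (h (c • x) y).fst = c • (h x y).fst
      rw [← algebraMap_smul F[ε] c x, LinearMap.map_smulₛₗ, LinearMap.smul_apply, smul_eq_mul,
        TrivSqZeroExt.fst_mul, smul_eq_mul]
      exact congrArg (· * (h x y).fst) (add_zero c))
    (by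
      rintro ⟨x⟩ ⟨y⟩ ⟨y'⟩
      change (h x (y + y')).fst = (h x y).fst + (h x y').fst
      simp)
    (by
      rintro c ⟨x⟩ ⟨y⟩
      change (h x (c • y)).fst = c • (h x y).fst
      rw [← algebraMap_smul F[ε] c y, map_smul, smul_eq_mul, TrivSqZeroExt.fst_mul]
      rfl)

/-- The reduced form is given by `b(v + 𝔦 V, w + 𝔦 V) = h(v, w) + 𝔦`. -/
lemma reducedForm_mk (h : SesqForm F V) (v w : V) :
    reducedForm h (Submodule.Quotient.mk v) (Submodule.Quotient.mk w) = (h v w).fst := rfl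

/-- The orthogonal group `O` of a bilinear form. -/
def orthogonalGroup {W : Type*} [AddCommGroup W] [Module F W] (b : LinearMap.BilinForm F W) :
    Subgroup (W ≃ₗ[F] W) where
  carrier := {g | ∀ u v, b (g u) (g v) = b u v}
  mul_mem' {a c} ha hc u v := by
    simp only [Set.mem_ofPred_eq] at ha hc
    rw [LinearEquiv.mul_apply, LinearEquiv.mul_apply, ha, hc]
  one_mem' u v := rfl
  inv_mem' {a} ha u v := by
    have := ha (a⁻¹ u) (a⁻¹ v)
    rw [← LinearEquiv.mul_apply, ← LinearEquiv.mul_apply, mul_inv_cancel] at this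
    exact this.symm

/-- `b` has rank `m` and type `c`: in some basis its matrix is diagonal, with diagonal
`1, -1, …, 1, -c` if `m` is even and `1, -1, …, 1, -1, -c` if `m` is odd. -/
def HasType {W : Type*} [AddCommGroup W] [Module F W] (b : LinearMap.BilinForm F W)
    (m : ℕ) (c : F) : Prop :=
  ∃ e : Module.Basis (Fin m) F W, ∀ i j : Fin m, b (e i) (e j) =
    if i = j then (if (i : ℕ) + 1 = m then -c else (-1) ^ (i : ℕ)) else 0

end

end RamifiedWeil

/-! Write `f_v = e_v ± e_{-v}`. Moving `v` by an element of `V₀` only rescales `e_v` and `e_{-v}`,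
by the same scalar, so up to scalars `f_v` depends only on the class of `v` in `W` modulo sign. The
unitary map `w ↦ w + a ε h(x, w) x` is trivial modulo `V₀`, and it multiplies `f_v` by `χ(-2 a b(v,
x)²)`. Since `χ` is primitive, these eigenvalues for all `a` and `x` determine the function `b(v,
·)²`, hence the class of `v` up to sign. So the `f_v` of distinct classes are linearly independent,
and a `U`-submodule containing a combination of them contains each `f_v` that occurs in it
(`mem_of_sum_eigenvectors_mem`).

By a Witt-type argument, reflections and `-1` act transitively on the non-zero vectors of `W` of a
given length (`rel_of_reflections`), and these maps lift to `U` (`exists_unitary_mk_eq`). Hence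
`Top^±(s)` is spanned by the `f_v` with `b(v, v) = t`, any one of them generates it, and it is
irreducible. Its degree is half the number of non-zero vectors of length `t`; as these form one
orbit of `O`, that number is the index of a stabilizer.

For the explicit degrees, `b` is diagonalized and hyperbolic planes `x² - y²` are split off, which
leaves a form of rank one, counted by the quadratic character, or the plane `x² - c y²`. -/

namespace RamifiedWeil

/-! ### Counting vectors of given length -/

section Counting

variable {F : Type*} [Field F] [Fintype F] [DecidableEq F]

/-- Each `u ≠ 0` determines `v`; the value `u = 0` contributes all `v` when `a = 0` and none
otherwise. -/
lemma sum_indicator_mul_eq (a : F) :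
    ∑ u : F, ∑ v : F, (if u * v = a then (1 : ℤ) else 0) =
      (Fintype.card F : ℤ) - 1 + if a = 0 then (Fintype.card F : ℤ) else 0 := by
  have h1 : ∀ u ∈ Finset.univ.erase (0 : F), ∑ v : F, (if u * v = a then (1 : ℤ) else 0) = 1 := by
    intro u hu
    have hu0 : u ≠ 0 := Finset.ne_of_mem_erase hu
    rw [Finset.sum_eq_single (u⁻¹ * a)]
    · simp [hu0]
    · intro v _ hv
      rw [if_neg]
      rintro rfl
      exact hv (by field_simp)
    · simp
  rw [← Finset.add_sum_erase _ _ (Finset.mem_univ (0 : F)), Finset.sum_congr rfl h1]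
  have h2 : ∑ v : F, (if 0 * v = a then (1 : ℤ) else 0) =
      if a = 0 then (Fintype.card F : ℤ) else 0 := by
    by_cases ha : a = 0
    · simp [ha]
    · simp [ha, Ne.symm ha]
  rw [h2, Finset.sum_const, Finset.card_erase_of_mem (Finset.mem_univ _), Finset.card_univ]
  have := Fintype.card_pos (α := F)
  push_cast [Nat.cast_sub this, nsmul_eq_mul]
  ring

/-- The number of solutions of `x ^ 2 - c * y ^ 2 = a`. -/
def binaryCount (c a : F) : ℤ := ∑ x : F, ∑ y : F, if x ^ 2 - c * y ^ 2 = a then 1 else 0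

lemma binaryCount_one (hF : (2 : F) ≠ 0) (a : F) :
    binaryCount 1 a = (Fintype.card F : ℤ) - 1 + if a = 0 then (Fintype.card F : ℤ) else 0 := by
  rw [← sum_indicator_mul_eq, binaryCount, ← Fintype.sum_prod_type', ← Fintype.sum_prod_type']
  -- As 2 is invertible, `x + y` and `x - y` are new coordinates, and the form becomes a product.
  let e : F × F ≃ F × F :=
    { toFun := fun p => (p.1 + p.2, p.1 - p.2)
      invFun := fun p => ((p.1 + p.2) / 2, (p.1 - p.2) / 2)
      left_inv := fun p => by ext <;> simp <;> field_simp <;> ring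
      right_inv := fun p => by ext <;> simp <;> field_simp <;> ring }
  refine Fintype.sum_equiv e _ _ fun p => ?_
  have : p.1 ^ 2 - 1 * p.2 ^ 2 = (e p).1 * (e p).2 := by
    change _ = (p.1 + p.2) * (p.1 - p.2)
    ring
  rw [this]

lemma sum_indicator_sq (hF : ringChar F ≠ 2) (a : F) :
    ∑ y : F, (if y ^ 2 = a then (1 : ℤ) else 0) = quadraticChar F a + 1 := by
  rw [← quadraticChar_card_sqrts hF, Finset.sum_boole]
  congr 2
  ext
  simp

lemma quadraticChar_inv_mul_nonsquare {δ : F} (hδ : ¬ IsSquare δ) (a : F) :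
    quadraticChar F (δ⁻¹ * a) = -quadraticChar F a := by
  have h1 : quadraticChar F δ⁻¹ = -1 := by
    rw [quadraticChar_neg_one_iff_not_isSquare]
    rwa [isSquare_inv]
  rw [map_mul, h1, neg_one_mul]

/-- For fixed `x` the equations are `y² = k` and `y² = δ⁻¹ k` with the same `k = x² - a`. The
quadratic characters are opposite, so together there are always two solutions. This reduces the
count for `δ` to the hyperbolic one. -/
lemma binaryCount_one_add_nonsquare (hF : ringChar F ≠ 2) {δ : F} (hδ : ¬ IsSquare δ) (a : F) :
    binaryCount 1 a + binaryCount δ a = 2 * Fintype.card F := by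
  have hδ0 : δ ≠ 0 := by
    rintro rfl
    exact hδ (IsSquare.zero)
  rw [binaryCount, binaryCount, ← Finset.sum_add_distrib]
  have : ∀ x : F, ∑ y : F, (if x ^ 2 - 1 * y ^ 2 = a then (1 : ℤ) else 0) +
      ∑ y : F, (if x ^ 2 - δ * y ^ 2 = a then (1 : ℤ) else 0) = 2 := by
    intro x
    have h1 : ∀ y : F, x ^ 2 - 1 * y ^ 2 = a ↔ y ^ 2 = x ^ 2 - a := fun y => by
      constructor <;> intro h <;> linear_combination -h
    have h2 : ∀ y : F, x ^ 2 - δ * y ^ 2 = a ↔ y ^ 2 = δ⁻¹ * (x ^ 2 - a) := fun y => by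
      rw [eq_inv_mul_iff_mul_eq₀ hδ0]
      constructor <;> intro h <;> linear_combination -h
    simp only [h1, h2, sum_indicator_sq hF, quadraticChar_inv_mul_nonsquare hδ]
    ring
  rw [Finset.sum_congr rfl fun x _ => this x, Finset.sum_const, Finset.card_univ, nsmul_eq_mul,
    mul_comm]

/-- The diagonal entries of the form of rank `m` and type `c`. -/
def diagWeight (m : ℕ) (c : F) (i : Fin m) : F :=
  if (i : ℕ) + 1 = m then -c else (-1) ^ (i : ℕ)

/-- The number of vectors of length `t` for the diagonal form of rank `m` and type `c`. -/
def diagCount (m : ℕ) (c t : F) : ℤ :=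
  ∑ x : Fin m → F, if ∑ i, diagWeight m c i * x i ^ 2 = t then 1 else 0

lemma sum_fin_succ_pi {α M : Type*} [Fintype α] [AddCommMonoid M] {n : ℕ}
    (f : (Fin (n + 1) → α) → M) : ∑ x, f x = ∑ a : α, ∑ x : Fin n → α, f (Fin.cons a x) := by
  rw [← Fintype.sum_prod_type']
  exact (Fintype.sum_equiv (Fin.consEquiv fun _ => α) _ _ fun _ => rfl).symm

lemma diagCount_one (hF : ringChar F ≠ 2) {c : F} (hc : c ≠ 0) (t : F) :
    diagCount 1 c t = quadraticChar F (-t / c) + 1 := by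
  rw [diagCount, sum_fin_succ_pi, ← sum_indicator_sq hF]
  refine Finset.sum_congr rfl fun a _ => ?_
  have : -c * a ^ 2 = t ↔ a ^ 2 = -t / c := by
    rw [eq_div_iff hc]
    constructor <;> intro h <;> linear_combination -h
  simp [diagWeight, ← this]

lemma diagCount_two (c t : F) : diagCount 2 c t = binaryCount c t := by
  rw [diagCount, sum_fin_succ_pi, binaryCount]
  refine Finset.sum_congr rfl fun a _ => ?_
  rw [sum_fin_succ_pi]
  refine Finset.sum_congr rfl fun b _ => ?_
  simp [diagWeight, Fin.sum_univ_two, sub_eq_add_neg]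

/-- The first two coordinates carry the hyperbolic plane, and a shift by two preserves the
alternating signs of the others. The condition `m ≠ 0` keeps index 1 from being the last one, whose
weight is `-c`. -/
lemma diagCount_add_two (hF : (2 : F) ≠ 0) {m : ℕ} (hm : m ≠ 0) (c t : F) :
    diagCount (m + 2) c t =
      (Fintype.card F : ℤ) ^ m * (Fintype.card F - 1) + Fintype.card F * diagCount m c t := by
  have h1 : diagCount (m + 2) c t =
      ∑ z : Fin m → F, binaryCount 1 (t - ∑ i, diagWeight m c i * z i ^ 2) := by
    rw [diagCount, sum_fin_succ_pi]
    simp only [sum_fin_succ_pi, binaryCount]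
    rw [Finset.sum_comm_cycle]
    refine Finset.sum_congr rfl fun z _ => ?_
    refine Finset.sum_congr rfl fun a _ => ?_
    refine Finset.sum_congr rfl fun b _ => ?_
    have hw : ∀ i : Fin m, diagWeight (m + 2) c i.succ.succ = diagWeight m c i := fun i => by
      simp [diagWeight, pow_add, add_right_comm _ 2]
    have h0 : diagWeight (m + 2) c 0 = 1 := by simp [diagWeight]
    have h1 : diagWeight (m + 2) c (Fin.succ 0) = -1 := by simp [diagWeight, hm]
    congr 1
    rw [Fin.sum_univ_succ, Fin.sum_univ_succ]
    simp only [Fin.cons_zero, Fin.cons_succ, hw, h0, h1, eq_iff_iff]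
    constructor <;> intro h <;> linear_combination h
  have h2 : ∀ z : Fin m → F, (t - ∑ i, diagWeight m c i * z i ^ 2 = 0) ↔
      ∑ i, diagWeight m c i * z i ^ 2 = t := fun z => by rw [sub_eq_zero, eq_comm]
  rw [h1, diagCount, Finset.mul_sum]
  simp only [binaryCount_one hF, Finset.sum_add_distrib, h2, mul_ite, mul_one, mul_zero]
  simp [mul_sub]

lemma diagCount_odd (hF : ringChar F ≠ 2) {c : F} (hc : c ≠ 0) (t : F) (r : ℕ) :
    diagCount (2 * r + 1) c t =
      (Fintype.card F : ℤ) ^ (2 * r) + (Fintype.card F : ℤ) ^ r * quadraticChar F (-t / c) := by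
  induction r with
  | zero =>
    rw [show 2 * 0 + 1 = 1 by norm_num, diagCount_one hF hc]
    ring
  | succ r ih =>
    rw [show 2 * (r + 1) + 1 = 2 * r + 1 + 2 by ring,
      diagCount_add_two (Ring.two_ne_zero hF) (by omega), ih]
    ring

lemma diagCount_even (hF : ringChar F ≠ 2) (c t : F) (r : ℕ) :
    diagCount (2 * (r + 1)) c t = (Fintype.card F : ℤ) ^ (2 * r + 1) +
      (Fintype.card F : ℤ) ^ r * (binaryCount c t - Fintype.card F) := by
  induction r with
  | zero =>
    rw [show 2 * (0 + 1) = 2 by norm_num, diagCount_two]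
    ring
  | succ r ih =>
    rw [show 2 * (r + 1 + 1) = 2 * (r + 1) + 2 by ring,
      diagCount_add_two (Ring.two_ne_zero hF) (by omega), ih]
    ring

end Counting

/-! ### Diagonalization of symmetric bilinear forms over finite fields -/

section Classification

variable {F : Type*} [Field F] {W : Type*} [AddCommGroup W] [Module F W]

/-- Polarization: if every length vanishes, then `2 b(x, y) = 0` for all `x` and `y`. -/
lemma exists_self_ne_zero (hF : (2 : F) ≠ 0) {b : LinearMap.BilinForm F W}
    (hsymm : ∀ x y, b x y = b y x) (hsep : ∀ x, (∀ y, b x y = 0) → x = 0) [Nontrivial W] :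
    ∃ x, b x x ≠ 0 := by
  by_contra! hall
  obtain ⟨x, hx⟩ := exists_ne (0 : W)
  refine hx (hsep x fun y => ?_)
  have h1 := hall (x + y)
  simp only [map_add, LinearMap.add_apply, hall, hsymm y x, zero_add, add_zero, ← two_mul] at h1
  exact (mul_eq_zero.1 h1).resolve_left hF

lemma restrict_ker_separating {b : LinearMap.BilinForm F W}
    (hsymm : ∀ x y, b x y = b y x) (hsep : ∀ x, (∀ y, b x y = 0) → x = 0) {v : W}
    (hv : b v v ≠ 0) (x : LinearMap.ker (b v))
    (hx : ∀ y, b.restrict (LinearMap.ker (b v)) x y = 0) : x = 0 := by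
  refine Subtype.ext (hsep x fun y => ?_)
  have hxv : b x v = 0 := by rw [hsymm]; exact x.2
  -- The projection of `y` to the complement of `v`; it has the same pairing with `x`, because `x ⊥
  -- v`.
  have hy : y - (b v y / b v v) • v ∈ LinearMap.ker (b v) := by
    rw [LinearMap.mem_ker, map_sub, map_smul, smul_eq_mul, div_mul_cancel₀ _ hv, sub_self]
  have := hx ⟨_, hy⟩
  simpa [hxv] using this

lemma finrank_ker_add_one [FiniteDimensional F W] {b : LinearMap.BilinForm F W} {v : W}
    (hv : b v v ≠ 0) : Module.finrank F (LinearMap.ker (b v)) + 1 = Module.finrank F W := by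
  refine Module.Dual.finrank_ker_add_one_of_ne_zero fun h => hv ?_
  rw [h, LinearMap.zero_apply]

lemma exists_mul_sq_add_mul_sq [Fintype F] (hF : ringChar F ≠ 2) {d e : F} (hd : d ≠ 0)
    (he : e ≠ 0) (a : F) : ∃ x y : F, d * x ^ 2 + e * y ^ 2 = a := by
  have h1 : (Polynomial.C d * Polynomial.X ^ 2).degree = 2 := Polynomial.degree_C_mul_X_pow 2 hd
  have h2 : (Polynomial.C e * Polynomial.X ^ 2 - Polynomial.C a).degree = 2 := by
    rw [Polynomial.degree_sub_eq_left_of_degree_lt] <;> rw [Polynomial.degree_C_mul_X_pow 2 he]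
    · rfl
    · exact Polynomial.degree_C_le.trans_lt (by norm_num)
  obtain ⟨x, y, hxy⟩ := FiniteField.exists_root_sum_quadratic h1 h2
    (FiniteField.odd_card_of_char_ne_two hF)
  refine ⟨x, y, ?_⟩
  simp only [Polynomial.eval_mul, Polynomial.eval_C, Polynomial.eval_pow, Polynomial.eval_X,
    Polynomial.eval_sub] at hxy
  linear_combination hxy

/-- Two orthogonal anisotropic vectors span a plane `d x² + e y²`, which represents every element of
a finite field of odd order. -/
lemma exists_self_eq [Fintype F] (hF : ringChar F ≠ 2) [FiniteDimensional F W]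
    {b : LinearMap.BilinForm F W} (hsymm : ∀ x y, b x y = b y x)
    (hsep : ∀ x, (∀ y, b x y = 0) → x = 0) (hW : 2 ≤ Module.finrank F W) (a : F) :
    ∃ x, b x x = a := by
  have h2 : (2 : F) ≠ 0 := Ring.two_ne_zero hF
  have : Nontrivial W := Module.nontrivial_of_finrank_pos (R := F) (by omega)
  obtain ⟨v, hv⟩ := exists_self_ne_zero h2 hsymm hsep
  have hk := finrank_ker_add_one hv
  have : Nontrivial (LinearMap.ker (b v)) :=
    Module.nontrivial_of_finrank_pos (R := F) (by omega)
  obtain ⟨w, hw⟩ := exists_self_ne_zero (b := b.restrict (LinearMap.ker (b v))) h2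
    (fun x y => hsymm x y) (restrict_ker_separating hsymm hsep hv)
  have hw : b w w ≠ 0 := hw
  have hvw : b v w = 0 := w.2
  have hwv : b w v = 0 := by rw [hsymm, hvw]
  obtain ⟨x, y, hxy⟩ := exists_mul_sq_add_mul_sq hF hv hw a
  refine ⟨x • v + y • (w : W), ?_⟩
  simp only [map_add, map_smul, LinearMap.add_apply, LinearMap.smul_apply, hvw, hwv, smul_eq_mul]
  linear_combination hxy

lemma isSquare_neg_or_isSquare_neg_div [Fintype F] {δ : F}
    (hδ : ¬ IsSquare δ) (d : F) : IsSquare (-d) ∨ IsSquare (-d / δ) := by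
  classical
  rw [or_iff_not_imp_left]
  intro h
  have hd : -d / δ ≠ 0 := by
    refine div_ne_zero ?_ ?_
    · rintro h0
      exact h (h0 ▸ IsSquare.zero)
    · rintro rfl
      exact hδ IsSquare.zero
  rw [← quadraticChar_one_iff_isSquare hd, div_eq_mul_inv, map_mul,
    quadraticChar_neg_one_iff_not_isSquare.2 h,
    quadraticChar_neg_one_iff_not_isSquare.2 (by rwa [isSquare_inv])]
  norm_num

/-- In rank at least two every length occurs, so a vector of prescribed length splits off. In rank
one the length is fixed only modulo squares, which leaves the alternatives `-1` and `-δ`. The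
weights `w` are arbitrary so that the induction can shift them. -/
lemma exists_diagonal_basis [Fintype F] (hF : ringChar F ≠ 2) {δ : F} (hδ : ¬ IsSquare δ) (n : ℕ) :
    ∀ {W : Type*} [AddCommGroup W] [Module F W] [FiniteDimensional F W]
      (b : LinearMap.BilinForm F W) (_ : ∀ x y, b x y = b y x)
      (_ : ∀ x, (∀ y, b x y = 0) → x = 0) (_ : Module.finrank F W = n + 1)
      (w : ℕ → F) (_ : ∀ i, w i ≠ 0),
      ∃ c, (c = 1 ∨ c = δ) ∧ ∃ e : Module.Basis (Fin (n + 1)) F W, ∀ i j, b (e i) (e j) =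
        if i = j then (if (i : ℕ) + 1 = n + 1 then -c else w i) else 0 := by
  have h2 : (2 : F) ≠ 0 := Ring.two_ne_zero hF
  induction n with
  | zero =>
    intro W _ _ _ b hsymm hsep hW w hw
    have : Nontrivial W := Module.nontrivial_of_finrank_pos (R := F) (by omega)
    obtain ⟨v, hv⟩ := exists_self_ne_zero h2 hsymm hsep
    have hc : ∃ c, (c = 1 ∨ c = δ) ∧ c ≠ 0 ∧ IsSquare (-(b v v) / c) := by
      rcases isSquare_neg_or_isSquare_neg_div hδ (b v v) with h | h
      · exact ⟨1, Or.inl rfl, one_ne_zero, by simpa using h⟩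
      · refine ⟨δ, Or.inr rfl, ?_, h⟩
        rintro rfl
        exact hδ IsSquare.zero
    obtain ⟨c, hc, hc0, k, hk⟩ := hc
    have hk0 : k ≠ 0 := by
      rintro rfl
      rw [mul_zero, div_eq_zero_iff, neg_eq_zero] at hk
      exact hk.elim hv hc0
    have hv0 : k⁻¹ • v ≠ 0 := by
      refine smul_ne_zero (inv_ne_zero hk0) ?_
      rintro rfl
      simp at hv
    refine ⟨c, hc, (FiniteDimensional.basisSingleton (Fin 1) hW (k⁻¹ • v) hv0), fun i j => ?_⟩
    rw [if_pos (Fin.ext (by omega)), if_pos (by omega)]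
    simp only [FiniteDimensional.basisSingleton_apply, map_smul, LinearMap.smul_apply, smul_eq_mul]
    rw [div_eq_iff hc0] at hk
    field_simp
    linear_combination -hk
  | succ n ih =>
    intro W _ _ _ b hsymm hsep hW w hw
    obtain ⟨v, hv⟩ := exists_self_eq hF hsymm hsep (by omega) (w 0)
    have hv0 : b v v ≠ 0 := hv ▸ hw 0
    have hk := finrank_ker_add_one hv0
    obtain ⟨c, hc, e, he⟩ := ih (b.restrict (LinearMap.ker (b v))) (fun x y => hsymm x y)
      (restrict_ker_separating hsymm hsep hv0) (by omega) (fun i => w (i + 1)) (fun i => hw _)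
    refine ⟨c, hc, Module.Basis.mkFinCons v e ?_ ?_, ?_⟩
    · intro a x hx hax
      have := congrArg (b v) hax
      rw [map_add, map_smul, LinearMap.mem_ker.1 hx, add_zero, map_zero, smul_eq_mul] at this
      exact (mul_eq_zero.1 this).resolve_right hv0
    · intro z
      refine ⟨-(b v z / b v v), ?_⟩
      rw [LinearMap.mem_ker, map_add, map_smul, smul_eq_mul, neg_mul, div_mul_cancel₀ _ hv0,
        add_neg_cancel]
    · intro i j
      rw [Module.Basis.coe_mkFinCons]
      refine Fin.cases ?_ (fun i => ?_) i <;> refine Fin.cases ?_ (fun j => ?_) j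
      · simp [hv]
      · rw [if_neg (Fin.succ_ne_zero j).symm]
        exact (e j).2
      · rw [if_neg (Fin.succ_ne_zero i), hsymm]
        exact (e i).2
      · have := he i j
        simpa using this

lemma hasType_one_or_nonsquare [Fintype F] (hF : ringChar F ≠ 2) {δ : F} (hδ : ¬ IsSquare δ)
    [FiniteDimensional F W] {b : LinearMap.BilinForm F W} (hsymm : ∀ x y, b x y = b y x)
    (hsep : ∀ x, (∀ y, b x y = 0) → x = 0) {m : ℕ} (hm : Module.finrank F W = m) (hm0 : m ≠ 0) :
    HasType b m 1 ∨ HasType b m δ := by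
  obtain ⟨n, rfl⟩ := Nat.exists_eq_succ_of_ne_zero hm0
  obtain ⟨c, rfl | rfl, h⟩ := exists_diagonal_basis hF hδ n b hsymm hsep hm
    (fun i => (-1) ^ i) (fun i => pow_ne_zero _ (neg_ne_zero.2 one_ne_zero))
  · exact Or.inl h
  · exact Or.inr h

end Classification

/-! ### Reflections and transitivity on vectors of given length -/

section Witt

variable {F : Type*} [Field F] {W : Type*} [AddCommGroup W] [Module F W]

lemma exists_apply_ne_zero_apply_ne_zero {R M N : Type*} [Ring R] [AddCommGroup M] [Module R M]
    [AddCommGroup N] [Module R N] {f g : M →ₗ[R] N} (hf : f ≠ 0) (hg : g ≠ 0) :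
    ∃ x, f x ≠ 0 ∧ g x ≠ 0 := by
  by_contra! hall
  obtain ⟨x, hx⟩ := DFunLike.ne_iff.1 hf
  obtain ⟨y, hy⟩ := DFunLike.ne_iff.1 hg
  rw [LinearMap.zero_apply] at hx hy
  -- Now `x` lies only in the kernel of `g` and `y` only in that of `f`, so `x + y` lies in neither.
  have hfy : f y = 0 := by
    by_contra h
    exact hy (hall y h)
  refine hy ?_
  have := hall (x + y) (by rwa [map_add, hfy, add_zero])
  rwa [map_add, hall x hx, zero_add] at this

/-- The product of the functionals `b(v - w, ·)` and `b(v + w, ·)` vanishes identically, so one of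
them is zero. -/
lemma eq_or_eq_neg_of_sq_eq {b : LinearMap.BilinForm F W}
    (hsep : ∀ x, (∀ y, b x y = 0) → x = 0) {v w : W} (h : ∀ x, b v x ^ 2 = b w x ^ 2) :
    v = w ∨ v = -w := by
  rw [← sub_eq_zero, ← add_eq_zero_iff_eq_neg]
  by_contra! hne
  have h1 : ∀ {u}, u ≠ 0 → b u ≠ 0 := fun hu hbu => hu (hsep _ fun y => by simp [hbu])
  obtain ⟨x, hx1, hx2⟩ := exists_apply_ne_zero_apply_ne_zero (h1 hne.1) (h1 hne.2)
  rw [map_sub, LinearMap.sub_apply] at hx1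
  rw [map_add, LinearMap.add_apply] at hx2
  refine mul_ne_zero hx1 hx2 ?_
  linear_combination h x

/-- Any transitive relation containing the graphs of `-1` and of all reflections relates any two
non-zero vectors of the same length. -/
lemma rel_of_reflections (hF : (2 : F) ≠ 0) {b : LinearMap.BilinForm F W}
    (hsymm : ∀ x y, b x y = b y x) (hsep : ∀ x, (∀ y, b x y = 0) → x = 0)
    {R : W → W → Prop} (htrans : ∀ {x y z}, R x y → R y z → R x z) (hneg : ∀ x, R x (-x))
    (hrefl : ∀ x u, b x x ≠ 0 → R u (u - (2 * (b x x)⁻¹ * b x u) • x))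
    {u w : W} (hu : u ≠ 0) (hw : w ≠ 0) (huw : b u u = b w w) : R u w := by
  -- The reflection in `u - w` takes `u` to `w`. It exists when `b(u - w, u - w) = 2 (b(u, u) - b(u,
  -- w))` is non-zero.
  have key : ∀ {u w}, b u u = b w w → b u u ≠ b u w → R u w := by
    intro u w huw hne
    have h1 : b (u - w) (u - w) = 2 * (b u u - b u w) := by
      simp only [map_sub, LinearMap.sub_apply, hsymm w u, ← huw]
      ring
    have h2 : b (u - w) u = b u u - b u w := by
      rw [map_sub, LinearMap.sub_apply, hsymm w u]
    have h3 : b u u - b u w ≠ 0 := sub_ne_zero.2 hne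
    have := hrefl (u - w) u (h1 ▸ mul_ne_zero hF h3)
    rw [h1, h2, mul_inv, ← mul_assoc, mul_inv_cancel₀ hF, one_mul, inv_mul_cancel₀ h3, one_smul,
      sub_sub_cancel] at this
    exact this
  by_cases h1 : b u u = b u w
  · by_cases h0 : b u u = 0
    · have hb : ∀ {u}, u ≠ 0 → b u ≠ 0 := fun hu hbu => hu (hsep _ fun y => by simp [hbu])
      obtain ⟨x, hxu, hxw⟩ := exists_apply_ne_zero_apply_ne_zero (hb hu) (hb hw)
      -- Here `u` and `w` are isotropic and orthogonal. The multiple of `u` makes `z` isotropic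
      -- while keeping its pairings with `u` and `w` non-zero, so two reflections lead from `u`
      -- through `z` to `w`.
      let z := x - (b x x / (2 * b u x)) • u
      have hz : b z z = 0 := by
        simp only [z, map_sub, map_smul, LinearMap.sub_apply, LinearMap.smul_apply, smul_eq_mul,
          hsymm x u, h0]
        field_simp
        ring
      have huz : b u z = b u x := by
        simp [z, h0]
      have hwz : b w z = b w x := by
        simp [z, hsymm w u, ← h1, h0]
      refine htrans (key (w := z) ?_ ?_) (key ?_ ?_)
      · rw [h0, hz]
      · rw [h0, huz]
        exact hxu.symm
      · rw [hz, ← huw, h0]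
      · rw [hz, hsymm, hwz]
        exact hxw.symm
    -- If `b(u, w) = b(u, u) ≠ 0`, then `b(u, -w) ≠ b(u, u)`, so `u` can be reflected to `-w` and
    -- then negated.
    · have := htrans (key (u := u) (w := -w) ?_ ?_) (hneg (-w))
      · rwa [neg_neg] at this
      · simpa using huw
      · rw [map_neg, ← h1]
        intro h
        have : 2 * b u u = 0 := by linear_combination h
        exact (mul_ne_zero hF h0) this
  · exact key huw h1

lemma orbit_orthogonalGroup (hF : (2 : F) ≠ 0) {b : LinearMap.BilinForm F W}
    (hsymm : ∀ x y, b x y = b y x) (hsep : ∀ x, (∀ y, b x y = 0) → x = 0) {u : W} (hu : u ≠ 0) :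
    MulAction.orbit (orthogonalGroup b) u = {w | w ≠ 0 ∧ b w w = b u u} := by
  ext w
  constructor
  · rintro ⟨g, rfl⟩
    exact ⟨(LinearEquiv.map_ne_zero_iff g.1).2 hu, g.2 u u⟩
  · rintro ⟨hw, huw⟩
    refine rel_of_reflections (R := fun x y => y ∈ MulAction.orbit (orthogonalGroup b) x) hF hsymm
      hsep ?_ ?_ ?_ hu hw huw.symm
    · intro x y z hxy hyz
      rwa [← MulAction.orbit_eq_iff.2 hxy]
    · intro x
      exact ⟨⟨LinearEquiv.neg F, fun x y => by simp⟩, rfl⟩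
    · intro x v hx
      have h2 : ((2 * (b x x)⁻¹) • b x) x = 2 := by
        simp [hx]
      refine ⟨⟨Module.reflection h2, fun y z => ?_⟩, Module.reflection_apply v h2⟩
      simp only [Module.reflection_apply, map_sub, map_smul, LinearMap.sub_apply,
        LinearMap.smul_apply, smul_eq_mul, hsymm y x]
      field_simp
      ring

end Witt

/-! ### The reduced form -/

section Reduced

variable {F : Type*} [Field F] {V : Type*} [AddCommGroup V] [Module F[ε] V]

@[simp] lemma fst_conj (a : F[ε]) : (conj F a).fst = a.fst := by simp [conj]

@[simp] lemma snd_conj (a : F[ε]) : (conj F a).snd = -a.snd := by simp [conj]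

lemma snd_form_self (hF : (2 : F) ≠ 0) {h : SesqForm F V} (hherm : IsHermitian h) (v : V) :
    (h v v).snd = 0 := by
  have h1 := congrArg TrivSqZeroExt.snd (hherm v v)
  rw [snd_conj] at h1
  have : 2 * (h v v).snd = 0 := by linear_combination h1
  exact (mul_eq_zero.1 this).resolve_left hF

lemma mem_V0_of_eps_smul_eq_zero [Module.Free F[ε] V] {v : V} (hv : (ε : F[ε]) • v = 0) :
    v ∈ V0 F V := by
  let e := Module.Free.chooseBasis F[ε] V
  have h1 : ∀ i, (e.repr v i).fst = 0 := fun i => by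
    have := congrArg (fun w => (e.repr w i).snd) hv
    simpa using this
  -- In `A` the annihilator of `ε` is `ε A`; freeness carries this over to `V` coordinatewise.
  have h2 : ∀ i, e.repr v i = ε * TrivSqZeroExt.inl (e.repr v i).snd := fun i => by
    ext <;> simp [h1]
  rw [← e.linearCombination_repr v, Finsupp.linearCombination_apply]
  refine (V0 F V).sum_mem fun i _ => ?_
  beta_reduce
  rw [h2, mul_smul]
  exact mem_V0.2 ⟨_, rfl⟩

variable [Module F V] [IsScalarTower F F[ε] V]

lemma reducedForm_symm {h : SesqForm F V} (hherm : IsHermitian h) (x y : ReducedSpace F V) :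
    reducedForm h x y = reducedForm h y x := by
  obtain ⟨v, rfl⟩ := Submodule.Quotient.mk_surjective _ x
  obtain ⟨w, rfl⟩ := Submodule.Quotient.mk_surjective _ y
  rw [reducedForm_mk, reducedForm_mk, hherm w v, fst_conj]

lemma reducedForm_separating [Module.Free F[ε] V] {h : SesqForm F V}
    (hnd : Nondegenerate h) (x : ReducedSpace F V) (hx : ∀ y, reducedForm h x y = 0) : x = 0 := by
  obtain ⟨v, rfl⟩ := Submodule.Quotient.mk_surjective _ x
  rw [Submodule.Quotient.mk_eq_zero]
  -- If `h(v, ·)` takes values in `ε A`, then `h(ε v, ·) = 0`, so `ε v = 0` by non-degeneracy.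
  refine mem_V0_of_eps_smul_eq_zero (hnd.1 (LinearMap.ext fun w => ?_))
  have h1 : (h v w).fst = 0 := hx (Submodule.Quotient.mk w)
  rw [LinearMap.map_smulₛₗ, LinearMap.smul_apply, map_zero, LinearMap.zero_apply]
  ext
  · simp [conj]
  · simp [conj]
    exact h1

lemma finrank_reducedSpace [Module.Free F[ε] V] [Module.Finite F[ε] V] :
    Module.finrank F (ReducedSpace F V) = Module.finrank F[ε] V := by
  let e := Module.finBasis F[ε] V
  let f : V →ₗ[F] Fin (Module.finrank F[ε] V) → F :=
    { toFun := fun v i => (e.repr v i).fst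
      map_add' := fun v w => by ext; simp
      map_smul' := fun c v => by
        ext i
        rw [← algebraMap_smul F[ε] c v, map_smul, Finsupp.smul_apply, smul_eq_mul,
          TrivSqZeroExt.fst_mul]
        rfl }
  have hf : Function.Surjective f := fun x => by
    refine ⟨e.equivFun.symm fun i => TrivSqZeroExt.inl (x i), ?_⟩
    ext i
    change (e.equivFun (e.equivFun.symm _) i).fst = _
    rw [LinearEquiv.apply_symm_apply, TrivSqZeroExt.fst_inl]
  have hker : (V0 F V).restrictScalars F = LinearMap.ker f := by
    ext v
    rw [Submodule.restrictScalars_mem, LinearMap.mem_ker]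
    constructor
    · intro hv
      obtain ⟨w, rfl⟩ := mem_V0.1 hv
      ext i
      simp [f]
    · intro hv
      refine mem_V0_of_eps_smul_eq_zero (e.repr.injective (Finsupp.ext fun i => ?_))
      have : (e.repr v i).fst = 0 := congrFun hv i
      ext <;> simp [this]
  have e1 := (Submodule.Quotient.restrictScalarsEquiv F (V0 F V)).symm ≪≫ₗ
    Submodule.quotEquivOfEq _ _ hker ≪≫ₗ f.quotKerEquivOfSurjective hf
  rw [e1.finrank_eq, Module.finrank_fin_fun]

/-- Reflections of `W` lift: for `x` with anisotropic image, `h(x, x)` is a non-zero constant of `F`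
because `h` is hermitian, hence a unit of `A`, and the unitary reflection in `x` reduces to the
orthogonal one. -/
lemma exists_unitary_mk_eq (hF : (2 : F) ≠ 0) [Module.Free F[ε] V] {h : SesqForm F V}
    (hherm : IsHermitian h) (hnd : Nondegenerate h) {v w : V} (hv : v ∉ V0 F V)
    (hw : w ∉ V0 F V) (hvw : (h v v).fst = (h w w).fst) :
    ∃ g : unitaryGroup h, (Submodule.Quotient.mk (g.1 v) : ReducedSpace F V) =
      Submodule.Quotient.mk w := by
  let R : ReducedSpace F V → ReducedSpace F V → Prop := fun x y =>
    ∃ g : unitaryGroup h, ∀ v, Submodule.Quotient.mk v = x → Submodule.Quotient.mk (g.1 v) = y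
  have hR : R (Submodule.Quotient.mk v) (Submodule.Quotient.mk w) := by
    refine rel_of_reflections hF (reducedForm_symm hherm) (reducedForm_separating hnd) ?_ ?_ ?_
      ?_ ?_ hvw
    · rintro x y z ⟨g, hg⟩ ⟨g', hg'⟩
      exact ⟨g' * g, fun v hv => hg' _ (hg v hv)⟩
    · intro x
      refine ⟨⟨LinearEquiv.neg F[ε], fun x y => by simp⟩, ?_⟩
      rintro v rfl
      rfl
    · intro x u hx
      obtain ⟨x, rfl⟩ := Submodule.Quotient.mk_surjective _ x
      rw [reducedForm_mk] at hx ⊢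
      set c := (h x x).fst with hc
      have hxx : h x x = TrivSqZeroExt.inl c := by
        ext
        · simp [hc]
        · simp [snd_form_self hF hherm]
      have hinv : (TrivSqZeroExt.inl c⁻¹ : F[ε]) * TrivSqZeroExt.inl c = 1 := by
        ext <;> simp [hx]
      have h2 : ((2 * (TrivSqZeroExt.inl c⁻¹ : F[ε])) • h x) x = 2 := by
        rw [LinearMap.smul_apply, hxx, smul_eq_mul, mul_assoc, hinv, mul_one]
      have hconj : conj F (TrivSqZeroExt.inl c⁻¹) = TrivSqZeroExt.inl c⁻¹ := by
        ext <;> simp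
      refine ⟨⟨Module.reflection h2, fun y z => ?_⟩, ?_⟩
      · simp only [Module.reflection_apply, map_sub, map_smul, LinearMap.map_smulₛₗ,
          LinearMap.sub_apply, LinearMap.smul_apply, smul_eq_mul, hherm x y, map_mul, hconj, hxx,
          map_ofNat]
        linear_combination (2 * 2 * (TrivSqZeroExt.inl c⁻¹ : F[ε]) * conj F (h x y) * h x z) * hinv
      · rintro v rfl
        rw [Module.reflection_apply, Submodule.Quotient.mk_sub, sub_right_inj,
          LinearMap.smul_apply, ← Submodule.Quotient.mk_smul]
        rw [← algebraMap_smul F[ε] (2 * _ * _) x, Submodule.Quotient.eq, ← sub_smul]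
        have : ∀ a : F[ε], a.fst = 0 → ∀ x : V, a • x ∈ V0 F V := fun a ha x => by
          refine mem_V0.2 ⟨(TrivSqZeroExt.inl a.snd : F[ε]) • x, ?_⟩
          rw [smul_smul]
          congr 1
          ext <;> simp [ha]
        refine this _ ?_ x
        rw [reducedForm_mk]
        have h3 : TrivSqZeroExt.fst (2 : F[ε]) = 2 := rfl
        simp [TrivSqZeroExt.algebraMap_eq_inl, h3]
    · rwa [Ne, Submodule.Quotient.mk_eq_zero]
    · rwa [Ne, Submodule.Quotient.mk_eq_zero]
  obtain ⟨g, hg⟩ := hR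
  exact ⟨g, hg v rfl⟩

end Reduced

/-! ### Simultaneous eigenvectors with distinct eigenvalues -/

section Eigenvectors

variable {K X ι G : Type*} [Field K] [AddCommGroup X] [Module K X]

/-- Applying `ρ g - ψ g j` removes the term at `j` and multiplies the coefficient at `i` by `ψ g i -
ψ g j`, which is non-zero for a suitable `g`. -/
lemma mem_of_add_sum_eigenvectors_mem {ρ : G → Module.End K X} {f : ι → X}
    {ψ : G → ι → K} (hf : ∀ g i, ρ g (f i) = ψ g i • f i)
    (hψ : ∀ i j, i ≠ j → ∃ g, ψ g i ≠ ψ g j) {Y : Submodule K X}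
    (hY : ∀ g, ∀ x ∈ Y, ρ g x ∈ Y) {i : ι} (S : Finset ι) :
    i ∉ S → ∀ (a : K) (c : ι → K), a ≠ 0 → a • f i + ∑ j ∈ S, c j • f j ∈ Y → f i ∈ Y := by
  classical
  induction S using Finset.induction_on with
  | empty =>
    intro _ a c ha hc
    rw [Finset.sum_empty, add_zero] at hc
    exact (Y.smul_mem_iff ha).1 hc
  | insert j S hj ih =>
    intro hi a c ha hc
    rw [Finset.mem_insert, not_or] at hi
    obtain ⟨g, hg⟩ := hψ i j hi.1
    refine ih hi.2 (a * (ψ g i - ψ g j)) (fun k => c k * (ψ g k - ψ g j))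
      (mul_ne_zero ha (sub_ne_zero.2 hg)) ?_
    have h1 := Y.sub_mem (hY g _ hc) (Y.smul_mem (ψ g j) hc)
    convert h1 using 1
    rw [Finset.sum_insert hj]
    simp only [map_add, map_sum, map_smul, hf, smul_add, Finset.smul_sum, smul_smul, mul_sub,
      sub_smul, Finset.sum_sub_distrib, mul_comm (ψ g j)]
    abel

lemma mem_of_sum_eigenvectors_mem [Fintype ι] {ρ : G → Module.End K X} {f : ι → X}
    {ψ : G → ι → K} (hf : ∀ g i, ρ g (f i) = ψ g i • f i)
    (hψ : ∀ i j, i ≠ j → ∃ g, ψ g i ≠ ψ g j) {Y : Submodule K X}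
    (hY : ∀ g, ∀ x ∈ Y, ρ g x ∈ Y) {i : ι} (c : ι → K) (hc : c i ≠ 0)
    (hmem : ∑ j, c j • f j ∈ Y) : f i ∈ Y := by
  classical
  rw [← Finset.add_sum_erase _ _ (Finset.mem_univ i)] at hmem
  exact mem_of_add_sum_eigenvectors_mem hf hψ hY _ (Finset.notMem_erase i _) _ c hc hmem

lemma linearIndependent_of_eigenvectors [Fintype ι] {ρ : G → Module.End K X} {f : ι → X}
    {ψ : G → ι → K} (hf : ∀ g i, ρ g (f i) = ψ g i • f i)
    (hψ : ∀ i j, i ≠ j → ∃ g, ψ g i ≠ ψ g j) (hf0 : ∀ i, f i ≠ 0) : LinearIndependent K f := by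
  rw [Fintype.linearIndependent_iff]
  intro c hc i
  by_contra hci
  refine hf0 i ((Submodule.mem_bot K).1 (mem_of_sum_eigenvectors_mem hf hψ ?_ c hci ?_))
  · intro g x hx
    rw [(Submodule.mem_bot K).1 hx, map_zero]
    exact Submodule.zero_mem _
  · rw [hc]
    exact Submodule.zero_mem _

end Eigenvectors

/-! ### The Weil module -/

section Weil

variable {F : Type*} [Field F] {V : Type*} [AddCommGroup V] [Module F[ε] V]
  {h : SesqForm F V} {χ : AddChar F ℂ}

/-- The relation `y k ⊗ z = y ⊗ k z` of the induced module, with `y = x⁻¹`. -/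
lemma mk_inv_mul (k : polarization h) (x : HeisenbergUnitary h) (z : ℂ) :
    Representation.IndV.mk (polarization h).subtype (polChar h χ)
        ((k : HeisenbergUnitary h)⁻¹ * x) z =
      Representation.IndV.mk (polarization h).subtype (polChar h χ) x (polChar h χ k z) := by
  have h1 := Representation.Coinvariants.mk_inv_tmul
    (ρ := (Representation.leftRegular ℂ (HeisenbergUnitary h)).comp (polarization h).subtype)
    (τ := polChar h χ) (.single x 1) z k
  rw [MonoidHom.comp_apply, Representation.ofMulAction_single] at h1
  exact h1

/-- In `H ⋊ U` one has `g (0, v) = (0, g v) g`, and `g` fixes `ζ`. -/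
lemma weilRep_eVec (g : unitaryGroup h) (v : V) :
    weilRep h χ g (eVec h χ v) = eVec h χ (g.1 v) := by
  have h1 : (SemidirectProduct.inl (⟨0, v⟩ : Heisenberg h) : HeisenbergUnitary h)⁻¹ *
      (SemidirectProduct.inr g)⁻¹ =
      (SemidirectProduct.inr g)⁻¹ * (SemidirectProduct.inl (⟨0, g.1 v⟩ : Heisenberg h))⁻¹ := by
    rw [← mul_inv_rev, ← mul_inv_rev, inv_inj]
    refine SemidirectProduct.ext ?_ ?_
    · refine Heisenberg.ext ?_ ?_
      · change (0 : F[ε]) + 0 + h 0 (g.1 v) = 0 + 0 + h (g.1 v) ((1 : unitaryGroup h).1 0)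
        simp
      · change 0 + g.1 v = g.1 v + (1 : unitaryGroup h).1 0
        simp
    · simp
  rw [weilRep, eVec, MonoidHom.comp_apply, Representation.ind_mk, h1, eVec]
  let k : polarization h := ⟨SemidirectProduct.inr g, (V0 F V).zero_mem⟩
  have h2 : polChar h χ k 1 = 1 := by
    simp [polChar, k]
  have h3 := mk_inv_mul k (SemidirectProduct.inl (⟨0, g.1 v⟩ : Heisenberg h))⁻¹ (χ := χ) 1
  rw [h2] at h3
  exact h3

/-- This comes from the factorization `(0, v + z) = (0, v) (-h(v, z), z)`, whose second factor lies
in `(A, V₀)`. -/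
lemma eVec_add {v z : V} (hz : z ∈ V0 F V) :
    eVec h χ (v + z) = muChar χ (-h v z) • eVec h χ v := by
  let k : polarization h := ⟨SemidirectProduct.inl ⟨-h v z, z⟩, hz⟩
  have h1 : (SemidirectProduct.inl (⟨0, v + z⟩ : Heisenberg h) : HeisenbergUnitary h)⁻¹ =
      (k : HeisenbergUnitary h)⁻¹ * (SemidirectProduct.inl (⟨0, v⟩ : Heisenberg h))⁻¹ := by
    rw [← mul_inv_rev, inv_inj]
    change _ = SemidirectProduct.inl _ * SemidirectProduct.inl _
    rw [← map_mul]
    congr 1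
    exact Heisenberg.ext (by simp) (by simp)
  have h2 : polChar h χ k 1 = muChar χ (-h v z) • 1 := by
    simp [polChar, k]
  rw [eVec, eVec, h1, mk_inv_mul, h2, map_smul]

lemma eVec_add_eps_smul (v w : V) :
    eVec h χ (v + (ε : F[ε]) • w) = χ (-(2 * (h v w).fst)) • eVec h χ v := by
  have h1 : muChar χ (-h v ((ε : F[ε]) • w)) = χ (-(2 * (h v w).fst)) := by
    change χ (2 * (-h v ((ε : F[ε]) • w)).snd) = _
    congr 1
    simp
  rw [eVec_add (mem_V0.2 ⟨w, rfl⟩), h1]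

/-- The function on `H ⋊ U` underlying the coordinate form of `X` at `e_v`. -/
noncomputable def coordFun (h : SesqForm F V) (χ : AddChar F ℂ) (v : V)
    (y : HeisenbergUnitary h) : ℂ :=
  open scoped Classical in
  if y.left.vec - v ∈ V0 F V then muChar χ (y.left.scal - h v y.left.vec) else 0

lemma coordFun_mul (v : V) (y : HeisenbergUnitary h) (k : polarization h) :
    coordFun h χ v (y * k) = coordFun h χ v y * muChar χ k.1.left.scal := by
  have hk : y.right.1 k.1.left.vec ∈ V0 F V := map_mem_V0 y.right.1.toLinearMap k.2
  have h1 : (y * k).left.vec = y.left.vec + y.right.1 k.1.left.vec := rfl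
  have h2 : (y * k).left.scal = y.left.scal + k.1.left.scal +
    h y.left.vec (y.right.1 k.1.left.vec) := rfl
  rw [coordFun, coordFun, h1, h2, add_sub_right_comm, Submodule.add_mem_iff_left _ hk]
  split_ifs with hy
  -- As `y.left.vec ≡ v` modulo `V₀` and `h` vanishes on `V₀ × V₀`, both vectors pair equally with
  -- `V₀`, so the cross terms cancel. This equivariance lets `coord` descend to the coinvariants.
  · have h3 := form_V0_V0 h hy hk
    rw [map_sub, LinearMap.sub_apply, sub_eq_zero] at h3
    rw [← AddChar.map_add_eq_mul, h3, map_add]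
    congr 1
    abel
  · rw [zero_mul]

/-- The linear form on `X` taking the coordinate at `e_v`. -/
noncomputable def coord (h : SesqForm F V) (χ : AddChar F ℂ) (v : V) : WeilModule h χ →ₗ[ℂ] ℂ :=
  Representation.Coinvariants.lift _
    (TensorProduct.lift <| (Finsupp.lift (ℂ →ₗ[ℂ] ℂ) ℂ _ fun x =>
      coordFun h χ v x⁻¹ • LinearMap.id) ∘ₗ (MonoidAlgebra.coeffLinearEquiv ℂ).toLinearMap)
    fun k => by
      ext x
      have h1 := coordFun_mul (χ := χ) v (x⁻¹ * (k : HeisenbergUnitary h)⁻¹) k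
      rw [inv_mul_cancel_right] at h1
      simp [polChar, h1]

lemma coord_eVec (v w : V) :
    coord h χ v (eVec h χ w) = coordFun h χ v (SemidirectProduct.inl ⟨0, w⟩) := by
  simp [coord, eVec]

/-- The generator `e_v ± e_{-v}` of `Top^±(v)`. -/
noncomputable def topGen (h : SesqForm F V) (χ : AddChar F ℂ) (σ : ℤˣ) (v : V) : WeilModule h χ :=
  eVec h χ v + ((σ : ℤ) : ℂ) • eVec h χ (-v)

variable {σ : ℤˣ}

lemma weilRep_topGen (g : unitaryGroup h) (v : V) :
    weilRep h χ g (topGen h χ σ v) = topGen h χ σ (g.1 v) := by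
  rw [topGen, map_add, map_smul, weilRep_eVec, weilRep_eVec, map_neg, topGen]

lemma topGen_neg (v : V) : topGen h χ σ (-v) = ((σ : ℤ) : ℂ) • topGen h χ σ v := by
  have : ((σ : ℤ) : ℂ) * ((σ : ℤ) : ℂ) = 1 := by
    rw [← Int.cast_mul, ← Units.val_mul, Int.units_mul_self]
    simp
  rw [topGen, topGen, neg_neg, smul_add, smul_smul, this, one_smul, add_comm]

/-- Both terms acquire the same scalar because `h(-v, -w) = h(v, w)`. -/
lemma topGen_add_eps_smul (v w : V) :
    topGen h χ σ (v + (ε : F[ε]) • w) = χ (-(2 * (h v w).fst)) • topGen h χ σ v := by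
  rw [topGen, topGen, neg_add, ← smul_neg, eVec_add_eps_smul, eVec_add_eps_smul, smul_add,
    smul_comm (χ _)]
  simp

lemma exists_topGen_eq_smul {v w : V}
    (hvw : (Submodule.Quotient.mk v : ReducedSpace F V) = Submodule.Quotient.mk w) :
    ∃ c : ℂ, topGen h χ σ v = c • topGen h χ σ w := by
  obtain ⟨z, hz⟩ := mem_V0.1 ((Submodule.Quotient.eq _).1 hvw)
  rw [sub_eq_iff_eq_add'.1 hz]
  exact ⟨_, topGen_add_eps_smul w z⟩

lemma exists_topGen_eq_smul_of_eq_or_eq_neg {v w : V}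
    (hvw : (Submodule.Quotient.mk v : ReducedSpace F V) = Submodule.Quotient.mk w ∨
      (Submodule.Quotient.mk v : ReducedSpace F V) = -Submodule.Quotient.mk w) :
    ∃ c : ℂ, topGen h χ σ v = c • topGen h χ σ w := by
  rcases hvw with hvw | hvw
  · exact exists_topGen_eq_smul hvw
  · rw [← Submodule.Quotient.mk_neg] at hvw
    obtain ⟨c, hc⟩ := exists_topGen_eq_smul (h := h) (χ := χ) (σ := σ) hvw
    exact ⟨_, by rw [hc, topGen_neg, smul_smul]⟩

lemma topGen_mem_topConst (s : V) : topGen h χ σ s ∈ (topConst h χ σ s).toSubmodule :=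
  Submodule.subset_span ⟨1, by
    change weilRep h χ 1 _ = _
    rw [map_one]
    rfl⟩

lemma add_self_mem_V0_iff (hF : (2 : F) ≠ 0) {v : V} : v + v ∈ V0 F V ↔ v ∈ V0 F V := by
  refine ⟨fun hv => ?_, fun hv => (V0 F V).add_mem hv hv⟩
  have h1 := (V0 F V).smul_mem (TrivSqZeroExt.inl (2 : F)⁻¹) hv
  have h2 : (TrivSqZeroExt.inl (2 : F)⁻¹ : F[ε]) * 2 = 1 := by
    have h3 : TrivSqZeroExt.fst (2 : F[ε]) = 2 := rfl
    have h4 : TrivSqZeroExt.snd (2 : F[ε]) = 0 := rfl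
    ext <;> simp [h3, h4, hF]
  rwa [← two_smul F[ε] v, smul_smul, h2, one_smul] at h1

/-- The coordinate at `e_v` is 1: `h(v, v)` has no `ε`-part, and `e_{-v}` contributes nothing
because `-v` and `v` differ modulo `V₀`. -/
lemma topGen_ne_zero (hF : (2 : F) ≠ 0) (hherm : IsHermitian h) {v : V} (hv : v ∉ V0 F V) :
    topGen h χ σ v ≠ 0 := by
  intro h0
  have h1 := congrArg (coord h χ v) h0
  have h2 : -v - v ∉ V0 F V := by
    rwa [← neg_add', Submodule.neg_mem_iff, add_self_mem_V0_iff hF]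
  have h3 : muChar χ (0 - h v v) = 1 := by
    simp [muChar, dMap, snd_form_self hF hherm]
  rw [topGen, map_add, map_smul, coord_eVec, coord_eVec, coordFun, coordFun, map_zero,
    if_pos (by simp), if_neg (by simpa using h2), smul_zero, add_zero] at h1
  rw [SemidirectProduct.left_inl, h3] at h1
  exact one_ne_zero h1

/-- The unitary transformation `w ↦ w + a ε h(x, w) x`. -/
noncomputable def unipotent (h : SesqForm F V) (hherm : IsHermitian h) (a : F) (x : V) :
    unitaryGroup h :=
  ⟨LinearEquiv.ofLinearMap
    (LinearMap.id + (TrivSqZeroExt.inr a : F[ε]) • (h x).smulRight x)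
    (LinearMap.id - (TrivSqZeroExt.inr a : F[ε]) • (h x).smulRight x)
    (by
      ext w
      have h1 : (TrivSqZeroExt.inr a : F[ε]) * TrivSqZeroExt.inr a = 0 := by simp
      simp only [LinearMap.comp_apply, LinearMap.add_apply, LinearMap.sub_apply, LinearMap.id_apply,
        LinearMap.smul_apply, LinearMap.smulRight_apply, map_sub, map_smul]
      match_scalars
      · ring
      · linear_combination (-(h x w * h x x)) * h1)
    (by
      ext w
      have h1 : (TrivSqZeroExt.inr a : F[ε]) * TrivSqZeroExt.inr a = 0 := by simp
      simp only [LinearMap.comp_apply, LinearMap.add_apply, LinearMap.sub_apply, LinearMap.id_apply,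
        LinearMap.smul_apply, LinearMap.smulRight_apply, map_add, map_smul]
      match_scalars
      · ring
      · linear_combination (-(h x w * h x x)) * h1),
    fun u w => by
      have h1 : (TrivSqZeroExt.inr a : F[ε]) * TrivSqZeroExt.inr a = 0 := by simp
      -- Skewness of `a ε` cancels the first-order terms, and `ε² = 0` removes the second-order one.
      have h2 : conj F (TrivSqZeroExt.inr a) = -TrivSqZeroExt.inr a := by
        ext <;> simp
      change h (u + (TrivSqZeroExt.inr a : F[ε]) • h x u • x)
        (w + (TrivSqZeroExt.inr a : F[ε]) • h x w • x) = h u w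
      simp only [LinearMap.add_apply, LinearMap.smul_apply, map_add, map_smul,
        LinearMap.map_smulₛₗ, smul_eq_mul, h2, hherm x u]
      linear_combination (-(conj F (h x u) * h x w * h x x)) * h1⟩

lemma unipotent_apply (hherm : IsHermitian h) (a : F) (x w : V) :
    (unipotent h hherm a x).1 w =
      w + (ε : F[ε]) • ((TrivSqZeroExt.inl a * h x w : F[ε]) • x) := by
  have h1 : (ε : F[ε]) * TrivSqZeroExt.inl a = TrivSqZeroExt.inr a := by
    ext <;> simp
  change w + (TrivSqZeroExt.inr a : F[ε]) • (h x w • x) = _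
  rw [smul_smul, smul_smul, ← mul_assoc, h1]

lemma weilRep_unipotent_topGen (hherm : IsHermitian h) (a : F) (x v : V) :
    weilRep h χ (unipotent h hherm a x) (topGen h χ σ v) =
      χ (-(2 * (a * (h v x).fst ^ 2))) • topGen h χ σ v := by
  have h1 : (h x v).fst = (h v x).fst := by
    rw [hherm v x, fst_conj]
  rw [weilRep_topGen, unipotent_apply, topGen_add_eps_smul, map_smul]
  congr 4
  simp only [smul_eq_mul, TrivSqZeroExt.fst_mul, TrivSqZeroExt.fst_inl, h1]
  ring

lemma unitary_apply_notMem (g : unitaryGroup h) {v : V} (hv : v ∉ V0 F V) : g.1 v ∉ V0 F V := by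
  intro h1
  have h2 := map_mem_V0 (g⁻¹).1.toLinearMap h1
  have h3 : (g⁻¹).1.toLinearMap (g.1 v) = v := g.1.symm_apply_apply v
  exact hv (h3 ▸ h2)

variable [Module F V] [IsScalarTower F F[ε] V]

lemma neg_ne_self_reducedSpace (hF : (2 : F) ≠ 0) {x : ReducedSpace F V} (hx : x ≠ 0) :
    -x ≠ x := by
  intro hneg
  rw [neg_eq_iff_add_eq_zero, ← two_smul F x, smul_eq_zero] at hneg
  exact hneg.elim hF hx

/-- If all eigenvalues agreed, `a ↦ χ(2 a (b(v, x)² - b(w, x)²))` would be trivial for every `x`.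
Primitivity then forces equal squares, hence `v ≡ ±w`. -/
lemma exists_unipotent_character_ne (hF : (2 : F) ≠ 0) (hχ : χ.IsPrimitive) [Module.Free F[ε] V]
    (hnd : Nondegenerate h) {v w : V}
    (hvw : ¬ ((Submodule.Quotient.mk v : ReducedSpace F V) = Submodule.Quotient.mk w ∨
      (Submodule.Quotient.mk v : ReducedSpace F V) = -Submodule.Quotient.mk w)) :
    ∃ p : F × V, χ (-(2 * (p.1 * (h v p.2).fst ^ 2))) ≠ χ (-(2 * (p.1 * (h w p.2).fst ^ 2))) := by
  by_contra! hall
  refine hvw (eq_or_eq_neg_of_sq_eq (reducedForm_separating hnd) fun x => ?_)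
  obtain ⟨x, rfl⟩ := Submodule.Quotient.mk_surjective _ x
  rw [reducedForm_mk, reducedForm_mk, ← sub_eq_zero]
  by_contra hne
  refine hχ (mul_ne_zero hF hne) (DFunLike.ext _ _ fun a => ?_)
  have h1 := hall (-a, x)
  rw [AddChar.mulShift_apply, AddChar.one_apply]
  have h2 : χ (-(2 * (-a * (h v x).fst ^ 2)) + 2 * (-a * (h w x).fst ^ 2)) = 1 := by
    rw [AddChar.map_add_eq_mul, h1, ← AddChar.map_add_eq_mul, neg_add_cancel,
      AddChar.map_zero_eq_one]
  rw [← h2]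
  congr 1
  ring

section Degree

variable [Finite F] [Module.Finite F[ε] V]

instance : Finite (ReducedSpace F V) := by
  have : Finite F[ε] := inferInstanceAs (Finite (F × F))
  have : Finite V := Module.finite_of_finite F[ε]
  exact Finite.of_surjective _ (Submodule.Quotient.mk_surjective (V0 F V))

/-- Representatives modulo `±1` of the non-zero vectors of length `t` in the reduced space. -/
def HalfSphere (h : SesqForm F V) (t : F) : Type _ :=
  {x : ReducedSpace F V // (x ≠ 0 ∧ reducedForm h x x = t) ∧
    Finite.equivFin _ x < Finite.equivFin _ (-x)}

instance (t : F) : Finite (HalfSphere h t) := inferInstanceAs (Finite (Subtype _))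

lemma two_mul_card_halfSphere (hF : (2 : F) ≠ 0) (t : F) :
    2 * Nat.card (HalfSphere h t) =
      {x : ReducedSpace F V | x ≠ 0 ∧ reducedForm h x x = t}.ncard := by
  classical
  let e := Finite.equivFin (ReducedSpace F V)
  let A : Set (ReducedSpace F V) := {x | (x ≠ 0 ∧ reducedForm h x x = t) ∧ e x < e (-x)}
  have hA : A.ncard = Nat.card (HalfSphere h t) := (Nat.card_coe_set_eq A).symm
  have hneg : ((fun x => -x) '' A).ncard = A.ncard := Set.ncard_image_of_injective A neg_injective
  have hmem : ∀ x, x ∈ (fun x => -x) '' A ↔ (x ≠ 0 ∧ reducedForm h x x = t) ∧ e (-x) < e x := by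
    intro x
    rw [Set.image_neg_eq_neg, Set.mem_neg]
    simp [A]
  have hunion : {x : ReducedSpace F V | x ≠ 0 ∧ reducedForm h x x = t} =
      A ∪ (fun x => -x) '' A := by
    ext x
    rw [Set.mem_union, hmem, Set.mem_ofPred_eq, Set.mem_ofPred_eq, ← and_or_left, iff_self_and]
    rintro ⟨hx, -⟩
    exact lt_or_gt_of_ne fun h1 => neg_ne_self_reducedSpace hF hx (e.injective h1).symm
  -- The arbitrary enumeration `e` selects exactly one vector of each pair `{x, -x}`.
  have hdisj : Disjoint A ((fun x => -x) '' A) := by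
    rw [Set.disjoint_left]
    intro x hx hx'
    exact lt_asymm hx.2 ((hmem x).1 hx').2
  rw [hunion, Set.ncard_union_eq hdisj, hneg, hA, two_mul]

/-- A vector of `V` lifting a representative. -/
noncomputable def HalfSphere.lift {t : F} (i : HalfSphere h t) : V :=
  Function.surjInv (Submodule.Quotient.mk_surjective (V0 F V)) i.1

lemma HalfSphere.mk_lift {t : F} (i : HalfSphere h t) :
    Submodule.Quotient.mk i.lift = i.1 :=
  Function.surjInv_eq (Submodule.Quotient.mk_surjective (V0 F V)) i.1

lemma HalfSphere.lift_notMem {t : F} (i : HalfSphere h t) : i.lift ∉ V0 F V := by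
  rw [← Submodule.Quotient.mk_eq_zero, i.mk_lift]
  exact i.2.1.1

lemma HalfSphere.fst_form_lift {t : F} (i : HalfSphere h t) : (h i.lift i.lift).fst = t := by
  rw [← reducedForm_mk, i.mk_lift]
  exact i.2.1.2

lemma exists_halfSphere (hF : (2 : F) ≠ 0) {t : F} {v : V} (hv : v ∉ V0 F V)
    (hvt : (h v v).fst = t) : ∃ i : HalfSphere h t,
      (Submodule.Quotient.mk v : ReducedSpace F V) = Submodule.Quotient.mk i.lift ∨
      (Submodule.Quotient.mk v : ReducedSpace F V) = -Submodule.Quotient.mk i.lift := by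
  have hv0 : (Submodule.Quotient.mk v : ReducedSpace F V) ≠ 0 := by
    rwa [Ne, Submodule.Quotient.mk_eq_zero]
  have hne : Finite.equivFin _ (Submodule.Quotient.mk v : ReducedSpace F V) ≠
      Finite.equivFin _ (-Submodule.Quotient.mk v : ReducedSpace F V) := fun h1 =>
    neg_ne_self_reducedSpace hF hv0 ((Finite.equivFin _).injective h1).symm
  rcases lt_or_gt_of_ne hne with hlt | hlt
  · let i : HalfSphere h t := ⟨Submodule.Quotient.mk v, ⟨hv0, hvt⟩, hlt⟩
    exact ⟨i, Or.inl i.mk_lift.symm⟩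
  · let i : HalfSphere h t := ⟨-Submodule.Quotient.mk v, ⟨neg_ne_zero.2 hv0, by
      rw [map_neg, map_neg, LinearMap.neg_apply, neg_neg, reducedForm_mk, hvt]⟩, by rwa [neg_neg]⟩
    exact ⟨i, Or.inr (by rw [i.mk_lift, neg_neg])⟩

variable [Module.Free F[ε] V]

lemma HalfSphere.exists_unipotent_character_ne (hF : (2 : F) ≠ 0) (hχ : χ.IsPrimitive)
    (hnd : Nondegenerate h) {t : F} (i j : HalfSphere h t) (hij : i ≠ j) :
    ∃ p : F × V, χ (-(2 * (p.1 * (h i.lift p.2).fst ^ 2))) ≠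
      χ (-(2 * (p.1 * (h j.lift p.2).fst ^ 2))) := by
  refine RamifiedWeil.exists_unipotent_character_ne hF hχ hnd ?_
  rw [i.mk_lift, j.mk_lift]
  rintro (h1 | h1)
  · exact hij (Subtype.ext h1)
  · have hi := i.2.2
    rw [h1, neg_neg] at hi
    exact lt_asymm hi j.2.2

/-- One inclusion holds because `U` preserves length, the other because it is transitive on the
classes in `W` of primitive vectors of equal length. -/
lemma topConst_eq_span (hF : (2 : F) ≠ 0) (hherm : IsHermitian h) (hnd : Nondegenerate h) {s : V}
    (hs : s ∉ V0 F V) : (topConst h χ σ s).toSubmodule =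
      Submodule.span ℂ (Set.range fun i : HalfSphere h (h s s).fst => topGen h χ σ i.lift) := by
  apply le_antisymm
  · refine Submodule.span_le.2 ?_
    rintro _ ⟨g, rfl⟩
    change weilRep h χ g (topGen h χ σ s) ∈ _
    rw [weilRep_topGen]
    obtain ⟨i, hi⟩ := exists_halfSphere (h := h) hF (unitary_apply_notMem g hs)
      (congrArg TrivSqZeroExt.fst (g.2 s s))
    obtain ⟨c, hc⟩ := exists_topGen_eq_smul_of_eq_or_eq_neg (h := h) (χ := χ) (σ := σ) hi
    rw [hc]
    exact Submodule.smul_mem _ _ (Submodule.subset_span ⟨i, rfl⟩)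
  · refine Submodule.span_le.2 ?_
    rintro _ ⟨i, rfl⟩
    obtain ⟨g, hg⟩ := exists_unitary_mk_eq hF hherm hnd hs i.lift_notMem i.fst_form_lift.symm
    obtain ⟨c, hc⟩ := exists_topGen_eq_smul (h := h) (χ := χ) (σ := σ) hg.symm
    change topGen h χ σ i.lift ∈ _
    rw [hc, ← weilRep_topGen]
    exact Submodule.smul_mem _ _ (Submodule.subset_span ⟨g, rfl⟩)

lemma linearIndependent_topGen_lift (hF : (2 : F) ≠ 0) (hherm : IsHermitian h)
    (hnd : Nondegenerate h) (hχ : χ.IsPrimitive) (t : F) :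
    LinearIndependent ℂ fun i : HalfSphere h t => topGen h χ σ i.lift := by
  have := Fintype.ofFinite (HalfSphere h t)
  exact linearIndependent_of_eigenvectors
    (ρ := fun p : F × V => weilRep h χ (unipotent h hherm p.1 p.2))
    (fun p i => weilRep_unipotent_topGen hherm p.1 p.2 i.lift)
    (HalfSphere.exists_unipotent_character_ne hF hχ hnd)
    (fun i => topGen_ne_zero hF hherm i.lift_notMem)

lemma two_mul_finrank_topConst (hF : (2 : F) ≠ 0) (hherm : IsHermitian h)
    (hnd : Nondegenerate h) (hχ : χ.IsPrimitive) {s : V} (hs : s ∉ V0 F V) :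
    2 * Module.finrank ℂ (topConst h χ σ s).toSubmodule =
      {x : ReducedSpace F V | x ≠ 0 ∧ reducedForm h x x = (h s s).fst}.ncard := by
  have := Fintype.ofFinite (HalfSphere h (h s s).fst)
  rw [topConst_eq_span hF hherm hnd hs,
    finrank_span_eq_card (linearIndependent_topGen_lift hF hherm hnd hχ _),
    ← Nat.card_eq_fintype_card, two_mul_card_halfSphere hF]

/-- Eigenvalue separation puts some `topGen` into `Y`, and transitivity moves it to a vector
proportional to the generator at `s`. -/
lemma topConst_le_of_ne_bot (hF : (2 : F) ≠ 0) (hherm : IsHermitian h)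
    (hnd : Nondegenerate h) (hχ : χ.IsPrimitive) {s : V} (hs : s ∉ V0 F V)
    {Y : Submodule ℂ (WeilModule h χ)} (hY : ∀ g, ∀ x ∈ Y, weilRep h χ g x ∈ Y)
    (hle : Y ≤ (topConst h χ σ s).toSubmodule) (hne : Y ≠ ⊥) :
    (topConst h χ σ s).toSubmodule ≤ Y := by
  have := Fintype.ofFinite (HalfSphere h (h s s).fst)
  obtain ⟨x, hxY, hx0⟩ := Submodule.exists_mem_ne_zero_of_ne_bot hne
  have hx := hle hxY
  rw [topConst_eq_span hF hherm hnd hs, Submodule.mem_span_range_iff_exists_fun] at hx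
  obtain ⟨c, rfl⟩ := hx
  have hc : ∃ i, c i ≠ 0 := by
    by_contra! hall
    exact hx0 (Finset.sum_eq_zero fun i _ => by rw [hall, zero_smul])
  obtain ⟨i, hi⟩ := hc
  have hmem := mem_of_sum_eigenvectors_mem
    (ρ := fun p : F × V => weilRep h χ (unipotent h hherm p.1 p.2))
    (fun p i => weilRep_unipotent_topGen hherm p.1 p.2 i.lift)
    (HalfSphere.exists_unipotent_character_ne hF hχ hnd) (fun p => hY _) c hi hxY
  obtain ⟨g, hg⟩ := exists_unitary_mk_eq hF hherm hnd i.lift_notMem hs i.fst_form_lift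
  obtain ⟨d, hd⟩ := exists_topGen_eq_smul (h := h) (χ := χ) (σ := σ) hg.symm
  have hsY : topGen h χ σ s ∈ Y := by
    rw [hd, ← weilRep_topGen]
    exact Y.smul_mem _ (hY g _ hmem)
  refine Submodule.span_le.2 ?_
  rintro _ ⟨g, rfl⟩
  exact hY g _ hsY

lemma isIrreducible_topConst (hF : (2 : F) ≠ 0) (hherm : IsHermitian h)
    (hnd : Nondegenerate h) (hχ : χ.IsPrimitive) {s : V} (hs : s ∉ V0 F V) :
    (topConst h χ σ s).toRepresentation.IsIrreducible where
  exists_pair_ne := by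
    refine ⟨⊥, ⊤, fun h0 => topGen_ne_zero (χ := χ) (σ := σ) hF hherm hs ?_⟩
    have h1 : (⟨_, topGen_mem_topConst s⟩ : (topConst h χ σ s).toSubmodule) ∈
        (⊥ : Subrepresentation (topConst h χ σ s).toRepresentation).toSubmodule := by
      rw [h0]
      exact Submodule.mem_top
    exact congrArg Subtype.val ((Submodule.mem_bot ℂ).1 h1)
  eq_bot_or_eq_top Y := by
    rw [or_iff_not_imp_left]
    intro hY
    have hle := topConst_le_of_ne_bot hF hherm hnd hχ hs
      (Y := Y.toSubmodule.map (topConst h χ σ s).toSubmodule.subtype) ?_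
      (Submodule.map_subtype_le _ _) ?_
    · refine Subrepresentation.toSubmodule_injective (eq_top_iff.2 fun x _ => ?_)
      obtain ⟨y, hy, hyx⟩ := hle x.2
      rwa [← Subtype.ext hyx]
    · rintro g _ ⟨y, hy, rfl⟩
      exact ⟨_, Y.apply_mem_toSubmodule g hy, rfl⟩
    · intro h0
      rw [← Submodule.map_bot (topConst h χ σ s).toSubmodule.subtype] at h0
      exact hY (Subrepresentation.toSubmodule_injective
        (Submodule.map_injective_of_injective (Submodule.subtype_injective _) h0))

end Degree

end Weil

/-! ### Sphere sizes and degrees -/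

section Spheres

variable {F : Type*} [Field F] {W : Type*} [AddCommGroup W] [Module F W]

lemma ncard_sphere [Finite W] {b : LinearMap.BilinForm F W} (t : F) :
    ({w | w ≠ 0 ∧ b w w = t}.ncard : ℤ) =
      {w | b w w = t}.ncard - open scoped Classical in if t = 0 then 1 else 0 := by
  by_cases ht : t = 0
  · have h1 : {w | w ≠ 0 ∧ b w w = t} = {w | b w w = t} \ {0} := by
      ext w
      simp [and_comm]
    have h2 : (0 : W) ∈ {w | b w w = t} := by simp [ht]
    have h3 := Set.ncard_sdiff_singleton_add_one h2 (Set.toFinite _)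
    rw [h1, if_pos ht, ← h3]
    simp
  · rw [if_neg ht, sub_zero]
    congr 2
    ext w
    simp only [Set.mem_ofPred_eq, and_iff_right_iff_imp]
    rintro rfl rfl
    simp at ht

variable [Fintype F]

lemma ncard_length_eq [DecidableEq F] {b : LinearMap.BilinForm F W} {m : ℕ} {c : F}
    (hb : HasType b m c) (t : F) : ({w | b w w = t}.ncard : ℤ) = diagCount m c t := by
  obtain ⟨e, he⟩ := hb
  have h1 : ∀ x : Fin m → F, b (e.equivFun.symm x) (e.equivFun.symm x) =
      ∑ i, diagWeight m c i * x i ^ 2 := fun x => by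
    rw [Module.Basis.equivFun_symm_apply]
    simp only [map_sum, LinearMap.sum_apply, map_smul, LinearMap.smul_apply, he, smul_eq_mul,
      mul_ite, mul_zero]
    refine Finset.sum_congr rfl fun i _ => ?_
    rw [Finset.sum_ite_eq' Finset.univ i, if_pos (Finset.mem_univ i), diagWeight]
    split_ifs <;> ring
  have h2 : {w | b w w = t} =
      e.equivFun.symm '' {x | ∑ i, diagWeight m c i * x i ^ 2 = t} := by
    ext w
    rw [LinearEquiv.image_symm_eq_preimage, Set.mem_preimage, Set.mem_ofPred_eq, Set.mem_ofPred_eq,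
      ← h1, LinearEquiv.symm_apply_apply]
  rw [h2, Set.ncard_image_of_injective _ e.equivFun.symm.injective, diagCount, Finset.sum_boole,
    ← Set.ncard_coe_finset, Finset.coe_filter_univ]

lemma quadraticChar_neg_div [DecidableEq F] {a c : F} {s₁ s₂ s₃ : ℤ}
    (h1 : quadraticChar F (-1) = s₁) (h2 : quadraticChar F a = s₂)
    (h3 : quadraticChar F c⁻¹ = s₃) : quadraticChar F (-a / c) = s₁ * s₂ * s₃ := by
  rw [div_eq_mul_inv, neg_eq_neg_one_mul, map_mul, map_mul, h1, h2, h3]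

lemma ncard_sphere_odd [DecidableEq F] [Finite W] (hF : ringChar F ≠ 2)
    {b : LinearMap.BilinForm F W} {r : ℕ} {c : F} (hc : c ≠ 0) (hb : HasType b (2 * r + 1) c)
    (t : F) : ({w | w ≠ 0 ∧ b w w = t}.ncard : ℤ) =
      (Fintype.card F : ℤ) ^ (2 * r) + (Fintype.card F : ℤ) ^ r * quadraticChar F (-t / c) -
        if t = 0 then 1 else 0 := by
  rw [ncard_sphere, ncard_length_eq hb, diagCount_odd hF hc]
  congr

lemma ncard_sphere_even [DecidableEq F] [Finite W] (hF : ringChar F ≠ 2)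
    {b : LinearMap.BilinForm F W} {r : ℕ} {c : F} (hb : HasType b (2 * (r + 1)) c)
    (t : F) : ({w | w ≠ 0 ∧ b w w = t}.ncard : ℤ) =
      (Fintype.card F : ℤ) ^ (2 * r + 1) +
        (Fintype.card F : ℤ) ^ r * (binaryCount c t - Fintype.card F) -
        if t = 0 then 1 else 0 := by
  rw [ncard_sphere, ncard_length_eq hb, diagCount_even hF]
  congr

lemma binaryCount_nonsquare [DecidableEq F] (hF : ringChar F ≠ 2) {δ : F} (hδ : ¬ IsSquare δ)
    (t : F) : binaryCount δ t =
      (Fintype.card F : ℤ) + 1 - if t = 0 then (Fintype.card F : ℤ) else 0 := by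
  have h1 := binaryCount_one_add_nonsquare hF hδ t
  rw [binaryCount_one (Ring.two_ne_zero hF)] at h1
  linear_combination h1

end Spheres

end RamifiedWeil

theorem mainTheorem8 {F : Type*} [Field F] [Fintype F] (hF : ringChar F ≠ 2)
    {V : Type*} [AddCommGroup V] [Module F[ε] V] [Module.Free F[ε] V] [Module.Finite F[ε] V]
    [Module F V] [IsScalarTower F F[ε] V]
    (h : RamifiedWeil.SesqForm F V) (hherm : RamifiedWeil.IsHermitian h)
    (hnd : RamifiedWeil.Nondegenerate h)
    (χ : AddChar F ℂ) (hχ : χ.IsPrimitive)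
    (δ : F) (hδ : ¬ IsSquare δ)
    (m : ℕ) (hm : Module.finrank F[ε] V = m)
    (s : V) (hs : s ∉ RamifiedWeil.V0 F V)
    (t : F) (ht : h s s = algebraMap F F[ε] t)
    (q : ℕ) (hq : Fintype.card F = q)
    (b : LinearMap.BilinForm F (RamifiedWeil.ReducedSpace F V))
    (hb : b = RamifiedWeil.reducedForm h)
    (σ : ℤˣ) (deg : ℚ)
    (hdeg : deg = Module.finrank ℂ (RamifiedWeil.topConst h χ σ s).toSubmodule) :
    (RamifiedWeil.topConst h χ σ s).toRepresentation.IsIrreducible ∧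
    -- the degree is half the index of the stabilizer of any non-zero vector of length `t`
    (∀ u : RamifiedWeil.ReducedSpace F V, u ≠ 0 → b u u = t →
      deg = ((MulAction.stabilizer (RamifiedWeil.orthogonalGroup b) u).index : ℚ) / 2) ∧
    -- the cases below are exhaustive for `m ≥ 2`
    (RamifiedWeil.HasType b m 1 ∨ RamifiedWeil.HasType b m δ) ∧
    (m = 2 → RamifiedWeil.HasType b m δ → t ≠ 0) ∧
    ∀ r : ℕ, 1 ≤ r →
      (m = 2 * r + 1 →
        (RamifiedWeil.HasType b m 1 ∧ IsSquare (-1 : F) ∧ t ≠ 0 ∧ IsSquare t) ∨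
        (RamifiedWeil.HasType b m 1 ∧ ¬ IsSquare (-1 : F) ∧ ¬ IsSquare t) ∨
        (RamifiedWeil.HasType b m δ ∧ IsSquare (-1 : F) ∧ ¬ IsSquare t) ∨
        (RamifiedWeil.HasType b m δ ∧ ¬ IsSquare (-1 : F) ∧ t ≠ 0 ∧ IsSquare t) →
        deg = (q : ℚ) ^ r * ((q : ℚ) ^ r + 1) / 2) ∧
      (m = 2 * r + 1 →
        (RamifiedWeil.HasType b m 1 ∧ IsSquare (-1 : F) ∧ ¬ IsSquare t) ∨
        (RamifiedWeil.HasType b m 1 ∧ ¬ IsSquare (-1 : F) ∧ t ≠ 0 ∧ IsSquare t) ∨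
        (RamifiedWeil.HasType b m δ ∧ IsSquare (-1 : F) ∧ t ≠ 0 ∧ IsSquare t) ∨
        (RamifiedWeil.HasType b m δ ∧ ¬ IsSquare (-1 : F) ∧ ¬ IsSquare t) →
        deg = (q : ℚ) ^ r * ((q : ℚ) ^ r - 1) / 2) ∧
      (m = 2 * r → RamifiedWeil.HasType b m δ → t ≠ 0 →
        deg = (q : ℚ) ^ (r - 1) * ((q : ℚ) ^ r + 1) / 2) ∧
      (m = 2 * r → RamifiedWeil.HasType b m 1 → t ≠ 0 →
        deg = (q : ℚ) ^ (r - 1) * ((q : ℚ) ^ r - 1) / 2) ∧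
      (m = 2 * r → RamifiedWeil.HasType b m 1 → t = 0 →
        deg = ((q : ℚ) ^ r - 1) * ((q : ℚ) ^ (r - 1) + 1) / 2) ∧
      (m = 2 * r → 2 < m → RamifiedWeil.HasType b m δ → t = 0 →
        deg = ((q : ℚ) ^ r + 1) * ((q : ℚ) ^ (r - 1) - 1) / 2) ∧
      (m = 2 * r + 1 → RamifiedWeil.HasType b m 1 ∨ RamifiedWeil.HasType b m δ → t = 0 →
        deg = ((q : ℚ) ^ (2 * r) - 1) / 2) := by
  classical
  have h2 : (2 : F) ≠ 0 := Ring.two_ne_zero hF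
  have hsymm := RamifiedWeil.reducedForm_symm hherm
  have hsep := RamifiedWeil.reducedForm_separating hnd
  rw [← hb] at hsymm hsep
  have hst : (h s s).fst = t := by rw [ht]; rfl
  have hrank : Module.finrank F (RamifiedWeil.ReducedSpace F V) = m := by
    rw [RamifiedWeil.finrank_reducedSpace, hm]
  have hcount := RamifiedWeil.two_mul_finrank_topConst (σ := σ) h2 hherm hnd hχ hs
  rw [← hb, hst] at hcount
  set N : ℕ := {x : RamifiedWeil.ReducedSpace F V | x ≠ 0 ∧ b x x = t}.ncard with hN
  have hdegN : deg = ((N : ℤ) : ℚ) / 2 := by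
    rw [hdeg, ← hcount]
    push_cast
    ring
  have hs0 : (Submodule.Quotient.mk s : RamifiedWeil.ReducedSpace F V) ≠ 0 := by
    rwa [Ne, Submodule.Quotient.mk_eq_zero]
  -- The class of `s` itself has length `t`; this later rules out `t = 0` on the anisotropic plane.
  have hNpos : 0 < N := by
    rw [hN, Set.ncard_pos]
    refine ⟨Submodule.Quotient.mk s, hs0, ?_⟩
    rw [hb, RamifiedWeil.reducedForm_mk, hst]
  have hm0 : m ≠ 0 := by
    rintro rfl
    have := Module.finrank_zero_iff.1 hrank
    exact hs0 (Subsingleton.elim _ _)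
  have hδ0 : δ ≠ 0 := fun h0 => hδ (h0 ▸ IsSquare.zero)
  have hη1 : quadraticChar F (1 : F)⁻¹ = 1 := by simp
  have hηδ : quadraticChar F δ⁻¹ = -1 := by
    rwa [quadraticChar_neg_one_iff_not_isSquare, isSquare_inv]
  have hm1 : (-1 : F) ≠ 0 := neg_ne_zero.2 one_ne_zero
  have hsq : ∀ {a : F}, a ≠ 0 → IsSquare a → quadraticChar F a = 1 := fun ha =>
    (quadraticChar_one_iff_isSquare ha).2
  have hnsq : ∀ {a : F}, ¬ IsSquare a → quadraticChar F a = -1 :=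
    quadraticChar_neg_one_iff_not_isSquare.2
  have hns0 : ¬ IsSquare t → t ≠ 0 := fun h1 h0 => h1 (h0 ▸ IsSquare.zero)
  have hodd : ∀ {r : ℕ} {c : F} (k : ℤ), c ≠ 0 → m = 2 * r + 1 → RamifiedWeil.HasType b m c →
      t ≠ 0 → quadraticChar F (-t / c) = k → deg = (q : ℚ) ^ r * ((q : ℚ) ^ r + k) / 2 := by
    rintro r c k hc rfl htype ht0 hk
    rw [hdegN, RamifiedWeil.ncard_sphere_odd hF hc htype, if_neg ht0, hk, hq]
    push_cast
    ring
  have heven : ∀ {r : ℕ} {c : F} (k : ℤ), m = 2 * (r + 1) → RamifiedWeil.HasType b m c →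
      RamifiedWeil.binaryCount c t - q = k →
      (N : ℤ) = q ^ (2 * r + 1) + q ^ r * k - if t = 0 then 1 else 0 := by
    rintro r c k rfl htype hk
    rw [RamifiedWeil.ncard_sphere_even hF htype, hq, hk]
  have hbin1 : RamifiedWeil.binaryCount 1 t - q = -1 + if t = 0 then (q : ℤ) else 0 := by
    rw [RamifiedWeil.binaryCount_one h2, hq]
    ring
  have hbinδ : RamifiedWeil.binaryCount δ t - q = 1 - if t = 0 then (q : ℤ) else 0 := by
    rw [RamifiedWeil.binaryCount_nonsquare hF hδ, hq]
    ring
  refine ⟨RamifiedWeil.isIrreducible_topConst h2 hherm hnd hχ hs, ?_,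
    RamifiedWeil.hasType_one_or_nonsquare hF hδ hsymm hsep hrank hm0, ?_, fun r hr =>
      ⟨?_, ?_, ?_, ?_, ?_, ?_, ?_⟩⟩
  · intro u hu hut
    rw [MulAction.index_stabilizer, RamifiedWeil.orbit_orthogonalGroup h2 hsymm hsep hu, hut, hdegN]
    rfl
  · rintro rfl htype rfl
    -- The count of non-zero isotropic vectors here is `q + (1 - q) - 1 = 0`, contradicting `hNpos`.
    have h3 := heven (r := 0) _ rfl htype hbinδ
    simp only [if_true] at h3
    have h4 : (N : ℤ) = 0 := by rw [h3]; ring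
    omega
  · rintro hmr (⟨h3, h4, h5, h6⟩ | ⟨h3, h4, h5⟩ | ⟨h3, h4, h5⟩ | ⟨h3, h4, h5, h6⟩)
    · rw [hodd 1 one_ne_zero hmr h3 h5
        (RamifiedWeil.quadraticChar_neg_div (hsq hm1 h4) (hsq h5 h6) hη1)]
      push_cast
      rfl
    · rw [hodd 1 one_ne_zero hmr h3 (hns0 h5)
        (RamifiedWeil.quadraticChar_neg_div (hnsq h4) (hnsq h5) hη1)]
      push_cast
      rfl
    · rw [hodd 1 hδ0 hmr h3 (hns0 h5)
        (RamifiedWeil.quadraticChar_neg_div (hsq hm1 h4) (hnsq h5) hηδ)]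
      push_cast
      rfl
    · rw [hodd 1 hδ0 hmr h3 h5
        (RamifiedWeil.quadraticChar_neg_div (hnsq h4) (hsq h5 h6) hηδ)]
      push_cast
      rfl
  · rintro hmr (⟨h3, h4, h5⟩ | ⟨h3, h4, h5, h6⟩ | ⟨h3, h4, h5, h6⟩ | ⟨h3, h4, h5⟩)
    · rw [hodd (-1) one_ne_zero hmr h3 (hns0 h5)
        ((RamifiedWeil.quadraticChar_neg_div (hsq hm1 h4) (hnsq h5) hη1).trans (by norm_num))]
      push_cast
      ring
    · rw [hodd (-1) one_ne_zero hmr h3 h5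
        ((RamifiedWeil.quadraticChar_neg_div (hnsq h4) (hsq h5 h6) hη1).trans (by norm_num))]
      push_cast
      ring
    · rw [hodd (-1) hδ0 hmr h3 h5
        ((RamifiedWeil.quadraticChar_neg_div (hsq hm1 h4) (hsq h5 h6) hηδ).trans (by norm_num))]
      push_cast
      ring
    · rw [hodd (-1) hδ0 hmr h3 (hns0 h5)
        ((RamifiedWeil.quadraticChar_neg_div (hnsq h4) (hnsq h5) hηδ).trans (by norm_num))]
      push_cast
      ring
  all_goals obtain ⟨r, rfl⟩ := Nat.exists_eq_add_of_le' hr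
  · intro hmr htype ht0
    rw [hdegN, heven _ hmr htype hbinδ, if_neg ht0, if_neg ht0, add_tsub_cancel_right]
    push_cast
    ring
  · intro hmr htype ht0
    rw [hdegN, heven _ hmr htype hbin1, if_neg ht0, if_neg ht0, add_tsub_cancel_right]
    push_cast
    ring
  · intro hmr htype ht0
    rw [hdegN, heven _ hmr htype hbin1, if_pos ht0, if_pos ht0, add_tsub_cancel_right]
    push_cast
    ring
  · intro hmr _ htype ht0
    rw [hdegN, heven _ hmr htype hbinδ, if_pos ht0, if_pos ht0, add_tsub_cancel_right]
    push_cast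
    ring
  -- At `t = 0` the quadratic character term vanishes, so the type plays no role.
  · have key : ∀ {c : F}, c ≠ 0 → m = 2 * (r + 1) + 1 → RamifiedWeil.HasType b m c → t = 0 →
        deg = ((q : ℚ) ^ (2 * (r + 1)) - 1) / 2 := by
      rintro c hc rfl htype ht0
      rw [hdegN, RamifiedWeil.ncard_sphere_odd hF hc htype, if_pos ht0, ht0, neg_zero, zero_div,
        quadraticChar_zero, hq]
      push_cast
      ring
    rintro hmr (h3 | h3)
    · exact key one_ne_zero hmr h3
    · exact key hδ0 hmr h3
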